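/- Let $\mathcal A,\mathcal X,\mathcal Y$ be finite-dimensional Hilbert spaces of dimensions $d_A,d_X,d_Y\ge 1$. There are real constants $\kappa$ and $C$, depending only on $d_A,d_X,d_Y$, such that the following holds for every $n\ge 1$. Let $\mathbb Q$ be a quantum channel (a completely positive trace-preserving map) from operators on $\mathcal A\otimes\mathcal X^{\otimes n}$ to operators on $\mathcal Y^{\otimes n}$ that is non-signalling: for every $i$ and every state $\rho$ on $\mathcal A\otimes\mathcal X^{\otimes n}$, the reduced state of $\mathbb Q(\rho)$ on the $i$-th copy of $\mathcal Y$ depends only on the reduced state of $\rho$ on $\mathcal A$ and the $i$-th copy of $\mathcal X$. Then there are a measurable space $G$, a POVM $M(dg)$ on $G$ acting on $\mathcal A$, and quantum channels $\Phi_g$ from $\mathcal X$ to $\mathcal Y$, depending measurably on $g\in G$, such that the measure-and-prepare map $$\tilde{\mathbb Q}=\int_G \hat M(dg)\otimes\Phi_g^{\otimes n},\qquad \hat M(dg)(\rho)=\mathrm{tr}[M(dg)\,\rho],$$ is a quantum channel and, for every finite-dimensional Hilbert space $\mathcal Y'$, every operator $S$ on $\mathcal Y\otimes\mathcal Y'$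 (in particular every risk observable), every state $\rho_A$ on $\mathcal A$ and every state $\rho_{XY'}$ on $\mathcal X\otimes\mathcal Y'$, $$\bigl|\mathbf E[\mathbb Q]-\mathbf E[\tilde{\mathbb Q}]\bigr|\le \|S\|_\infty\left(\frac{\kappa}{n^{1/6}}+\frac{C}{n^{1/3}}\right).$$ Here $\|\cdot\|_\infty$ is the operator norm, and the expected risk of a channel $\mathbb P$ from $\mathcal A\otimes\mathcal X^{\otimes n}$ to $\mathcal Y^{\otimes n}$ is $$\mathbf E[\mathbb P]=\mathrm{tr}\Bigl[(\mathbb P\otimes\mathrm{id}_{\mathcal Y'^{\otimes n}})\bigl(\rho_A\otimes\rho_{XY'}^{\otimes n}\bigr)\,\bar S\Bigr],\qquad \bar S=\frac1n\sum_{i=1}^n S_i,$$ where $S_i$ acts as $S$ on the $i$-th copies of $\mathcal Y$ and $\mathcal Y'$ and as the identity on all the other registers. -/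

import Mathlib

open MeasureTheory
open scoped ComplexOrder

noncomputable section

namespace QLearn

/-- Operators on the Hilbert space `ℂ^ι`. Registers are described by finite index types:
`ι × κ` is the index type of a tensor product, `Fin n → ι` that of the `n`-th tensor power. -/
abbrev Op (ι : Type*) := Matrix ι ι ℂ

/-- Linear maps taking operators on `ℂ^ι` to operators on `ℂ^κ`. -/
abbrev SuperOp (ι κ : Type*) := Op ι →ₗ[ℂ] Op κ

/-- Quantum states: positive semidefinite operators of unit trace. -/
def IsState {ι : Type*} [Fintype ι] (ρ : Op ι) : Prop :=
  ρ.PosSemidef ∧ ρ.trace = 1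

/-- Partial trace over the second tensor factor. -/
def traceRight {ι κ : Type*} [Fintype κ] (M : Op (ι × κ)) : Op ι :=
  Matrix.of fun a b => ∑ k, M (a, k) (b, k)

/-- The map `Φ ⊗ id` applied to an operator on `ℂ^ι ⊗ ℂ^R`. -/
def tensorId {ι κ R : Type*} (Φ : SuperOp ι κ) (M : Op (ι × R)) : Op (κ × R) :=
  Matrix.of fun p q => Φ (Matrix.of fun x u => M (x, p.2) (u, q.2)) p.1 q.1

/-- Complete positivity: `Φ ⊗ id` preserves positivity for every finite-dimensional ancilla. -/
def IsCompletelyPositive {ι κ : Type*} [Fintype ι] [Fintype κ] (Φ : SuperOp ι κ) : Prop :=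
  ∀ (k : ℕ) (M : Op (ι × Fin k)), M.PosSemidef → (tensorId Φ M).PosSemidef

/-- Quantum channels: completely positive, trace-preserving maps. -/
structure IsChannel {ι κ : Type*} [Fintype ι] [Fintype κ] (Φ : SuperOp ι κ) : Prop where
  completelyPositive : IsCompletelyPositive Φ
  trace_preserving : ∀ M : Op ι, (Φ M).trace = M.trace

section Registers

variable {A X Y Z : Type*} {n : ℕ}

/-- Reduced operator on the `i`-th copy of `Y` of an operator on `Y^{⊗n}`. -/
def outMarginal [Fintype Y] (i : Fin n) (M : Op (Fin n → Y)) : Op Y :=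
  traceRight (M.submatrix (Equiv.funSplitAt i Y).symm (Equiv.funSplitAt i Y).symm)

/-- Reduced operator on `A` and the `i`-th copy of `X` of an operator on `A ⊗ X^{⊗n}`. -/
def inMarginal [Fintype X] (i : Fin n) (M : Op (A × (Fin n → X))) : Op (A × X) :=
  traceRight (M.submatrix
    (fun p : (A × X) × ({j : Fin n // j ≠ i} → X) =>
      (p.1.1, (Equiv.funSplitAt i X).symm (p.1.2, p.2)))
    (fun p : (A × X) × ({j : Fin n // j ≠ i} → X) =>
      (p.1.1, (Equiv.funSplitAt i X).symm (p.1.2, p.2))))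

/-- Non-signalling: for every `i`, the state of the `i`-th output register is a function of the
state of the training register and the `i`-th input register only. -/
def NonSignalling [Fintype A] [Fintype X] [Fintype Y]
    (Q : SuperOp (A × (Fin n → X)) (Fin n → Y)) : Prop :=
  ∀ (i : Fin n) (ρ σ : Op (A × (Fin n → X))), IsState ρ → IsState σ →
    inMarginal i ρ = inMarginal i σ → outMarginal i (Q ρ) = outMarginal i (Q σ)

/-- The tensor power `Φ^{⊗n}`, given by its action on matrix units. -/
def tensorPower [Fintype X] [DecidableEq X] (Φ : SuperOp X Y) (n : ℕ) :
    SuperOp (Fin n → X) (Fin n → Y) where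
  toFun M := Matrix.of fun y v =>
    ∑ x, ∑ u, M x u * ∏ i, Φ (Matrix.single (x i) (u i) 1) (y i) (v i)
  map_add' M N := by
    ext y v
    simp [add_mul, Finset.sum_add_distrib]
  map_smul' c M := by
    ext y v
    simp [Finset.mul_sum, mul_assoc]

/-- Positive operator-valued measures on a measurable space `G`, acting on `ℂ^A`. -/
structure POVM (G : Type*) [MeasurableSpace G] (A : Type*) [Fintype A] [DecidableEq A] where
  /-- the underlying countably additive matrix-valued measure -/
  measure : VectorMeasure G (Op A)
  posSemidef : ∀ s, MeasurableSet s → (measure s).PosSemidef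
  total : measure Set.univ = 1

/-- The `(a, b)` matrix entry of a POVM, as a complex measure. -/
def POVM.entry {G : Type*} [MeasurableSpace G] [Fintype A] [DecidableEq A]
    (M : POVM G A) (a b : A) : ComplexMeasure G :=
  M.measure.mapRange (Matrix.entryAddMonoidHom ℂ a b) (by
    change Continuous fun N : Op A => N a b
    fun_prop)

/-- The measure-and-prepare map `∫ M̂(dg) ⊗ Φ_g^{⊗n}`, where `M̂(dg)` sends an operator `ρ` on `A`
to `tr[M(dg) ρ]`: measure `M` on the training register and, on outcome `g`, apply `Φ_g` to each of
the `n` test registers. It is given by its action on matrix units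
`|a⟩⟨b| ⊗ |x⟩⟨u|`, for which `tr[M(dg) |a⟩⟨b|] = M(dg)_{b a}`. -/
def measurePrepare {G : Type*} [MeasurableSpace G] [Fintype A] [DecidableEq A]
    [Fintype X] [DecidableEq X] (M : POVM G A) (Φ : G → SuperOp X Y) (n : ℕ) :
    SuperOp (A × (Fin n → X)) (Fin n → Y) where
  toFun ρ := Matrix.of fun y v =>
    ∑ p, ∑ q, ρ p q * (M.entry q.1 p.1).integral
      (fun g => tensorPower (Φ g) n (Matrix.single p.2 q.2 1) y v) (ContinuousLinearMap.mul ℝ ℂ)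
  map_add' ρ σ := by
    ext y v
    simp [add_mul, Finset.sum_add_distrib]
  map_smul' c ρ := by
    ext y v
    simp [Finset.mul_sum, mul_assoc]

/-- The state `ρ_A ⊗ ρ_{XZ}^{⊗n}`, with the registers ordered as `(A ⊗ X^{⊗n}) ⊗ Z^{⊗n}`. -/
def inputState (n : ℕ) (ρA : Op A) (ρXZ : Op (X × Z)) :
    Op ((A × (Fin n → X)) × (Fin n → Z)) :=
  Matrix.of fun p q => ρA p.1.1 q.1.1 * ∏ i, ρXZ (p.1.2 i, p.2 i) (q.1.2 i, q.2 i)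

/-- The operator `S` acting on the `i`-th pair of registers `Y ⊗ Z` of `Y^{⊗n} ⊗ Z^{⊗n}`, and the
identity on all the others. -/
def localAt [DecidableEq Y] [DecidableEq Z] (i : Fin n) (S : Op (Y × Z)) :
    Op ((Fin n → Y) × (Fin n → Z)) :=
  Matrix.of fun p q =>
    S (p.1 i, p.2 i) (q.1 i, q.2 i) *
      if ∀ j, j ≠ i → p.1 j = q.1 j ∧ p.2 j = q.2 j then 1 else 0

/-- The symmetrized operator `n⁻¹ ∑ i, S_i`. -/
def symmetrized [DecidableEq Y] [DecidableEq Z] (n : ℕ) (S : Op (Y × Z)) :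
    Op ((Fin n → Y) × (Fin n → Z)) :=
  (n : ℂ)⁻¹ • ∑ i : Fin n, localAt i S

/-- The expected risk `tr[(Q ⊗ id)(ρ_A ⊗ ρ_{XZ}^{⊗n}) S̄]`. -/
def expectedRisk [Fintype Y] [DecidableEq Y] [Fintype Z] [DecidableEq Z]
    (Q : SuperOp (A × (Fin n → X)) (Fin n → Y)) (S : Op (Y × Z))
    (ρA : Op A) (ρXZ : Op (X × Z)) : ℂ :=
  (tensorId Q (inputState n ρA ρXZ) * symmetrized n S).trace

end Registers

/-- Operator norm of a matrix acting on the Hilbert space `ℂ^ι`. -/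
def opNorm {ι : Type*} [Fintype ι] [DecidableEq ι] (S : Op ι) : ℝ :=
  ‖Matrix.toEuclideanCLM (n := ι) (𝕜 := ℂ) S‖

end QLearn

end

/-! The risk sees a channel only through its averaged one-register marginals. View the Choi operator
of `Q` as a positive kernel `K` on `A ⊗ (X ⊗ Y)^{⊗n}`. By non-signalling, the marginal at register
`i` is unchanged if every other input is made maximally mixed (`NonSignalling.pairing_eq`). It then
suffices to approximate the operator on `A ⊗ X ⊗ Y` averaged over `i` by a separable one `∑ g, E g ⊗
C g`, with `E` a POVM and each `C g` the Choi operator of a channel.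

Measure all registers of `K` with an informationally complete frame. The outcomes `z` come with
effects on `A` summing to the identity, whose traces are nonnegative weights `p z` of total mass
`d_A`. The dual coefficients `D` of the frame recover the averaged marginal exactly from the
empirical means `n⁻¹ ∑ i, D (z i)`. These means need not form a positive operator, however.

Positivity comes from random splitting. Choose a uniformly random set `s` of registers to reveal.
The candidate `condOp` is the conditional expectation, given the revealed outcomes, of `(2/n) ∑ D (z
i)` over the unrevealed registers. It is positive because an unrevealed register, conditioned on
measurement outcomes elsewhere, carries a positive operator (`sum_fiber_mul_frameDual_nonneg`). The
unrevealed sum differs from the revealed one, which is already known, by twice a randomly signed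
average; that average is `O(1/√n)` in mean, so conditioning costs only `O(1/√n)`
(`sum_mul_norm_sub_condMean_le`). Neither permutation symmetry nor conditional independence is
needed.

Trace preservation makes the centred input statistics pairwise uncorrelated, so by a second-moment
bound the reduced operator of `condOp` on `X` is within `O(1/√n)` of the identity in mean
(`sum_mul_choiDefect_le`). `repair` makes it exact at proportional cost. The resulting rate
`n^{-1/2}` is better than the required `n^{-1/6}`. -/

noncomputable section

set_option linter.unusedSectionVars false

namespace QLearn

/-! ### Second moments and conditional expectation on finite weighted spaces -/

section Probability

variable {Ω W ι : Type*} [Fintype Ω]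

/-- The second moment of a sum of bounded, pairwise orthogonal random variables. -/
lemma sum_mul_norm_sum_sq_le [Fintype ι] [DecidableEq ι] (p : Ω → ℝ) (hp : ∀ ω, 0 ≤ p ω)
    (h : ι → Ω → ℂ) {H : ℝ} (hH : ∀ i ω, ‖h i ω‖ ≤ H)
    (horth : ∀ i j, i ≠ j → ∑ ω, (p ω : ℂ) * (h i ω * star (h j ω)) = 0) :
    ∑ ω, p ω * ‖∑ i, h i ω‖ ^ 2 ≤ Fintype.card ι * H ^ 2 * ∑ ω, p ω := by
  have key : ((∑ ω, p ω * ‖∑ i, h i ω‖ ^ 2 : ℝ) : ℂ)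
      = ((∑ i, ∑ ω, p ω * ‖h i ω‖ ^ 2 : ℝ) : ℂ) := by
    push_cast
    have hsq : ∀ w : ℂ, (‖w‖ : ℂ) ^ 2 = w * star w := fun w => by
      rw [Complex.star_def, Complex.mul_conj, Complex.normSq_eq_norm_sq]; push_cast; rfl
    simp_rw [hsq, star_sum, Finset.sum_mul_sum, Finset.mul_sum]
    rw [Finset.sum_comm]
    refine Finset.sum_congr rfl fun i _ => ?_
    rw [Finset.sum_comm, Finset.sum_eq_single i]
    · intro j _ hj
      exact horth i j hj.symm
    · simp
  rw [Complex.ofReal_inj] at key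
  rw [key]
  calc ∑ i, ∑ ω, p ω * ‖h i ω‖ ^ 2 ≤ ∑ _i : ι, ∑ ω, p ω * H ^ 2 := by
        gcongr with i _ ω _
        · exact hp ω
        · exact hH i ω
    _ = _ := by
        rw [← Finset.sum_mul]; simp; ring

/-- The mean absolute value of the empirical average of orthogonal random variables. -/
lemma sum_mul_norm_average_le {n : ℕ} (hn : 1 ≤ n) (p : Ω → ℝ) (hp : ∀ ω, 0 ≤ p ω)
    (h : Fin n → Ω → ℂ) {H : ℝ} (hH : ∀ i ω, ‖h i ω‖ ≤ H)
    (horth : ∀ i j, i ≠ j → ∑ ω, (p ω : ℂ) * (h i ω * star (h j ω)) = 0) :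
    ∑ ω, p ω * ‖(n : ℂ)⁻¹ * ∑ i, h i ω‖ ≤ H * (∑ ω, p ω) / √n := by
  have hn0 : (0 : ℝ) < n := by exact_mod_cast hn
  rcases isEmpty_or_nonempty Ω with hΩ | ⟨⟨ω₀⟩⟩
  · simp
  have hH0 : 0 ≤ H := (norm_nonneg _).trans (hH ⟨0, hn⟩ ω₀)
  have hP : 0 ≤ ∑ ω, p ω := Finset.sum_nonneg fun ω _ => hp ω
  have h2 := sum_mul_norm_sum_sq_le p hp h hH horth
  -- Cauchy–Schwarz with `√p` split off bounds the first moment by the second moment and the total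
  -- mass.
  have cs := Finset.sum_mul_sq_le_sq_mul_sq Finset.univ (fun ω => √(p ω))
    (fun ω => √(p ω) * ‖∑ i, h i ω‖)
  simp only [mul_pow, Real.sq_sqrt (hp _), ← mul_assoc, Real.mul_self_sqrt (hp _)] at cs
  have h3 : (∑ ω, p ω * ‖∑ i, h i ω‖) ≤ √n * H * ∑ ω, p ω := by
    refine abs_le_of_sq_le_sq' ?_ (by positivity) |>.2
    calc _ ≤ _ := cs
      _ ≤ (∑ ω, p ω) * (Fintype.card (Fin n) * H ^ 2 * ∑ ω, p ω) := by gcongr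
      _ = _ := by rw [mul_pow, mul_pow, Real.sq_sqrt hn0.le]; simp; ring
  have : ∑ ω, p ω * ‖(n : ℂ)⁻¹ * ∑ i, h i ω‖ = (∑ ω, p ω * ‖∑ i, h i ω‖) / n := by
    rw [Finset.sum_div]
    refine Finset.sum_congr rfl fun ω _ => ?_
    rw [norm_mul]; simp; ring
  rw [this, div_le_div_iff₀ hn0 (by positivity)]
  calc _ ≤ √n * H * (∑ ω, p ω) * √n := by gcongr
    _ = _ := by nth_rw 3 [← Real.mul_self_sqrt hn0.le]; ring

/-- The sum factorizes over coordinates, and the factor at `i` is `∑ w, f w`. It serves for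
independent random signs. -/
lemma sum_apply_mul_apply_eq_zero {n : ℕ} [DecidableEq W] [Fintype W] (f : W → ℂ)
    (hf : ∑ w, f w = 0) {i j : Fin n} (hij : i ≠ j) :
    ∑ s : Fin n → W, f (s i) * star (f (s j)) = 0 := by
  have : ∀ s : Fin n → W, f (s i) * star (f (s j))
      = ∏ k, (if k = i then f (s k) else 1) * (if k = j then star (f (s k)) else 1) := by
    intro s
    rw [Finset.prod_mul_distrib]
    simp
  simp_rw [this]
  rw [← Fintype.prod_sum
    (f := fun k w => (if k = i then f w else 1) * (if k = j then star (f w) else 1))]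
  apply Finset.prod_eq_zero (Finset.mem_univ i)
  simp [hij, hf]

variable [DecidableEq W]

/-- Conditional expectation of `h` given the value of `r`, for the weights `p`. -/
def condMean (p : Ω → ℝ) (r : Ω → W) (h : Ω → ℂ) (ω : Ω) : ℂ :=
  (∑ ω', if r ω' = r ω then (p ω' : ℂ) * h ω' else 0) /
    ((∑ ω', if r ω' = r ω then p ω' else 0 : ℝ) : ℂ)

lemma condMean_sub (p : Ω → ℝ) (r : Ω → W) (h k : Ω → ℂ) (ω : Ω) :
    condMean p r (fun ω' => h ω' - k ω') ω = condMean p r h ω - condMean p r k ω := by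
  rw [condMean, condMean, condMean, ← sub_div, ← Finset.sum_sub_distrib]
  congr 1
  refine Finset.sum_congr rfl fun ω' _ => ?_
  split_ifs <;> ring

lemma condMean_const_mul (p : Ω → ℝ) (r : Ω → W) (c : ℂ) (h : Ω → ℂ) (ω : Ω) :
    condMean p r (fun ω' => c * h ω') ω = c * condMean p r h ω := by
  rw [condMean, condMean, ← mul_div_assoc, Finset.mul_sum]
  congr 1
  refine Finset.sum_congr rfl fun ω' _ => ?_
  split_ifs <;> ring

lemma condMean_sum {κ : Type*} [Fintype κ] (p : Ω → ℝ) (r : Ω → W) (h : κ → Ω → ℂ) (ω : Ω) :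
    condMean p r (fun ω' => ∑ k, h k ω') ω = ∑ k, condMean p r (h k) ω := by
  simp_rw [condMean]
  rw [← Finset.sum_div, Finset.sum_comm]
  congr 1
  refine Finset.sum_congr rfl fun ω' _ => ?_
  split_ifs
  · rw [Finset.mul_sum]
  · simp

lemma weight_le_fiber (p : Ω → ℝ) (hp : ∀ ω, 0 ≤ p ω) (r : Ω → W) (ω : Ω) :
    p ω ≤ ∑ ω', if r ω' = r ω then p ω' else 0 := by
  have := Finset.single_le_sum (f := fun ω' => if r ω' = r ω then p ω' else 0)
    (fun ω' _ => by split_ifs <;> simp [hp]) (Finset.mem_univ ω)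
  simpa using this

/-- The weight `p ω` stays on both sides because on a fibre of mass zero `condMean` is the default
value `0` of a division by zero. -/
lemma mul_condMean_of_measurable (p : Ω → ℝ) (hp : ∀ ω, 0 ≤ p ω) (r : Ω → W) (h : Ω → ℂ)
    (hh : ∀ ω ω', r ω' = r ω → h ω' = h ω) (ω : Ω) :
    (p ω : ℂ) * condMean p r h ω = p ω * h ω := by
  rcases eq_or_ne (p ω) 0 with h0 | h0
  · simp [h0]
  have hpos : 0 < ∑ ω', if r ω' = r ω then p ω' else 0 :=
    lt_of_lt_of_le (lt_of_le_of_ne (hp ω) h0.symm) (weight_le_fiber p hp r ω)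
  congr 1
  have : (∑ ω', if r ω' = r ω then (p ω' : ℂ) * h ω' else 0)
      = ((∑ ω', if r ω' = r ω then p ω' else 0 : ℝ) : ℂ) * h ω := by
    push_cast
    rw [Finset.sum_mul]
    refine Finset.sum_congr rfl fun ω' _ => ?_
    split_ifs with hr
    · rw [hh ω ω' hr]
    · simp
  rw [condMean, this, mul_div_cancel_left₀]
  exact_mod_cast hpos.ne'

/-- Conditional expectation contracts `L¹`: apply the triangle inequality within each fibre, then
exchange the two sums. The remaining factor is fibre mass over fibre mass, at most `1` even when the
mass is zero. -/
lemma sum_mul_norm_condMean_le (p : Ω → ℝ) (hp : ∀ ω, 0 ≤ p ω) (r : Ω → W) (h : Ω → ℂ) :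
    ∑ ω, p ω * ‖condMean p r h ω‖ ≤ ∑ ω, p ω * ‖h ω‖ := by
  set P : Ω → ℝ := fun ω => ∑ ω', if r ω' = r ω then p ω' else 0 with hP
  have hP0 : ∀ ω, 0 ≤ P ω := fun ω => (hp ω).trans (weight_le_fiber p hp r ω)
  calc ∑ ω, p ω * ‖condMean p r h ω‖
      ≤ ∑ ω, ∑ ω', if r ω' = r ω then p ω * (p ω' * ‖h ω'‖) / P ω else 0 := by
        refine Finset.sum_le_sum fun ω _ => ?_
        rw [condMean, norm_div, Complex.norm_real, Real.norm_of_nonneg (hP0 ω), ← mul_div_assoc]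
        calc _ ≤ p ω * (∑ ω', if r ω' = r ω then p ω' * ‖h ω'‖ else 0) / P ω := by
              refine div_le_div_of_nonneg_right
                (mul_le_mul_of_nonneg_left ((norm_sum_le _ _).trans ?_) (hp ω)) (hP0 ω)
              refine Finset.sum_le_sum fun ω' _ => ?_
              split_ifs
              · rw [norm_mul, Complex.norm_real, Real.norm_of_nonneg (hp ω')]
              · simp
          _ = _ := by
              rw [Finset.mul_sum, Finset.sum_div]
              refine Finset.sum_congr rfl fun ω' _ => ?_
              split_ifs <;> simp
    _ = ∑ ω', p ω' * ‖h ω'‖ * (P ω' / P ω') := by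
        rw [Finset.sum_comm]
        refine Finset.sum_congr rfl fun ω' _ => ?_
        rw [← mul_div_assoc, hP, Finset.mul_sum, Finset.sum_div]
        refine Finset.sum_congr rfl fun ω _ => ?_
        by_cases hr : r ω' = r ω
        · simp only [hr, if_true]; ring
        · simp [hr, Ne.symm hr]
    _ ≤ ∑ ω', p ω' * ‖h ω'‖ := by
        refine Finset.sum_le_sum fun ω' _ => ?_
        exact mul_le_of_le_one_right (mul_nonneg (hp ω') (norm_nonneg _)) (div_self_le_one _)

end Probability

/-! ### Pairing a positive kernel with product operators -/

section Pairing

open Matrix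
open scoped Kronecker

variable {A B X Y Z : Type*} [Fintype A] [Fintype B] [Fintype X] [Fintype Y] [Fintype Z] {n : ℕ}

/-- Over `ℂ`, a real-valued quadratic form already forces hermiticity, so nonnegativity alone
suffices. -/
lemma posSemidef_of_nonneg {ι : Type*} [Fintype ι] (M : Op ι)
    (h : ∀ x : ι → ℂ, 0 ≤ star x ⬝ᵥ (M *ᵥ x)) : M.PosSemidef := by
  classical
  rw [← Matrix.isPositive_toEuclideanLin_iff, LinearMap.isPositive_iff_complex]
  intro x
  have hx := h x.ofLp
  have e : inner ℂ (M.toEuclideanLin x) x = star (star x.ofLp ⬝ᵥ (M *ᵥ x.ofLp)) := by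
    rw [EuclideanSpace.inner_eq_star_dotProduct, Matrix.ofLp_toLpLin, Matrix.toLin'_apply,
      star_dotProduct, star_star, dotProduct_comm]
  rw [Complex.nonneg_iff] at hx
  rw [e]
  refine ⟨?_, by simpa using hx.1⟩
  apply Complex.ext <;> simp [← hx.2]

/-- The pairing of the kernel `K` with `R ⊗ N₁ ⊗ ⋯ ⊗ Nₙ`, multilinear in the `Nᵢ`. -/
def pairing (K : Op (A × (Fin n → B))) (R : Op A) :
    MultilinearMap ℂ (fun _ : Fin n => Op B) ℂ :=
  ∑ a, ∑ a', ∑ β : Fin n → B, ∑ β' : Fin n → B, (R a a' * K (a, β) (a', β')) •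
    (MultilinearMap.mkPiAlgebra ℂ (Fin n) ℂ).compLinearMap
      (fun i => Matrix.entryLinearMap ℂ ℂ (β i) (β' i))

lemma pairing_apply (K : Op (A × (Fin n → B))) (R : Op A) (N : Fin n → Op B) :
    pairing K R N = ∑ a, ∑ a', ∑ β : Fin n → B, ∑ β' : Fin n → B,
      R a a' * K (a, β) (a', β') * ∏ i, N i (β i) (β' i) := by
  simp [pairing]

lemma pairing_eq_sum_single [DecidableEq A] (K : Op (A × (Fin n → B))) (R : Op A)
    (N : Fin n → Op B) :
    pairing K R N = ∑ a, ∑ a', R a a' * pairing K (single a a' 1) N := by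
  have : ∀ a a', pairing K (single a a' 1) N = ∑ β : Fin n → B, ∑ β' : Fin n → B,
      K (a, β) (a', β') * ∏ i, N i (β i) (β' i) := by
    intro a a'
    rw [pairing_apply, Finset.sum_eq_single a, Finset.sum_eq_single a']
    · simp
    · intro b _ hb
      simp [hb.symm]
    · simp
    · intro b _ hb
      simp [hb.symm]
    · simp
  simp_rw [this, pairing_apply, Finset.mul_sum, mul_assoc]

lemma pairing_sum_left {κ : Type*} [Fintype κ] (K : Op (A × (Fin n → B))) (R : κ → Op A)
    (N : Fin n → Op B) : pairing K (∑ k, R k) N = ∑ k, pairing K (R k) N := by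
  classical
  rw [pairing_eq_sum_single]
  simp_rw [fun k => pairing_eq_sum_single K (R k) N, Matrix.sum_apply, Finset.sum_mul]
  rw [Finset.sum_comm]
  conv_rhs => rw [Finset.sum_comm]
  conv_lhs => rw [Finset.sum_comm]
  refine Finset.sum_congr rfl fun a _ => ?_
  rw [Finset.sum_comm]

/-- On rank-one arguments the pairing is the quadratic form of `K` at the conjugated product vector.
The general case follows by spectral decomposition in each slot. -/
lemma pairing_vecMulVec_nonneg {K : Op (A × (Fin n → B))} (hK : K.PosSemidef) (w : A → ℂ)
    (v : Fin n → B → ℂ) :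
    0 ≤ pairing K (vecMulVec w (star w)) (fun i => vecMulVec (v i) (star (v i))) := by
  have := hK.dotProduct_mulVec_nonneg (fun α => star (w α.1) * ∏ i, star (v i (α.2 i)))
  convert this using 1
  rw [pairing_apply]
  simp only [dotProduct, mulVec, Fintype.sum_prod_type, Finset.mul_sum]
  refine Finset.sum_congr rfl fun a _ => ?_
  rw [Finset.sum_comm]
  refine Finset.sum_congr rfl fun β _ => Finset.sum_congr rfl fun a' _ =>
    Finset.sum_congr rfl fun β' _ => ?_
  simp [vecMulVec_apply, Finset.prod_mul_distrib]
  ring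

lemma pairing_nonneg {K : Op (A × (Fin n → B))} (hK : K.PosSemidef) {R : Op A}
    (hR : R.PosSemidef) {N : Fin n → Op B} (hN : ∀ i, (N i).PosSemidef) :
    0 ≤ pairing K R N := by
  obtain ⟨m, w, rfl⟩ := Matrix.posSemidef_iff_eq_sum_vecMulVec.mp hR
  choose k v hv using fun i => Matrix.posSemidef_iff_eq_sum_vecMulVec.mp (hN i)
  obtain rfl : N = fun i => ∑ j, vecMulVec (v i j) (star (v i j)) := funext hv
  rw [pairing_sum_left]
  refine Finset.sum_nonneg fun l _ => ?_
  rw [MultilinearMap.map_sum]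
  exact Finset.sum_nonneg fun r _ => pairing_vecMulVec_nonneg hK _ _

/-- Multilinearity turns a product statistic of the measurement outcomes into a change of operator
in each slot. All moments and conditional sums below are evaluated in this way. -/
lemma sum_prod_mul_pairing (K : Op (A × (Fin n → B))) (R : Op A) (E : Z → Op B)
    (c : Fin n → Z → ℂ) :
    ∑ z : Fin n → Z, (∏ i, c i (z i)) * pairing K R (fun i => E (z i))
      = pairing K R (fun i => ∑ w, c i w • E w) := by
  rw [MultilinearMap.map_sum]
  refine Finset.sum_congr rfl fun z _ => ?_
  rw [MultilinearMap.map_smul_univ, smul_eq_mul]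

/-- The operator on `A` representing `R ↦ pairing K R N`. -/
def effect [DecidableEq A] (K : Op (A × (Fin n → B))) (N : Fin n → Op B) : Op A :=
  Matrix.of fun a' a => pairing K (single a a' 1) N

lemma effect_posSemidef [DecidableEq A] {K : Op (A × (Fin n → B))} (hK : K.PosSemidef)
    {N : Fin n → Op B} (hN : ∀ i, (N i).PosSemidef) : (effect K N).PosSemidef := by
  refine posSemidef_of_nonneg _ fun x => ?_
  have := pairing_nonneg hK (posSemidef_vecMulVec_self_star x) hN
  rw [pairing_eq_sum_single] at this
  convert this using 1
  simp only [dotProduct, mulVec, Finset.mul_sum, effect, of_apply, vecMulVec_apply, Pi.star_apply]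
  rw [Finset.sum_comm]
  refine Finset.sum_congr rfl fun a _ => Finset.sum_congr rfl fun a' _ => ?_
  ring

lemma effect_trace [DecidableEq A] (K : Op (A × (Fin n → B))) (N : Fin n → Op B) :
    (effect K N).trace = pairing K 1 N := by
  rw [pairing_eq_sum_single, Matrix.trace]
  refine Finset.sum_congr rfl fun a _ => ?_
  rw [Finset.sum_eq_single a]
  · simp [effect]
  · intro b _ hb
    simp [hb.symm]
  · simp

/-- Lets the scalar weight `frameWeight` control every entry of the corresponding effect on `A`. -/
lemma norm_apply_le_trace {ι : Type*} [Fintype ι] {M : Op ι} (hM : M.PosSemidef) (a b : ι) :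
    ‖M a b‖ ≤ M.trace.re := by
  obtain ⟨m, v, rfl⟩ := Matrix.posSemidef_iff_eq_sum_vecMulVec.mp hM
  rw [trace_sum, Complex.re_sum, Matrix.sum_apply]
  refine (norm_sum_le _ _).trans (Finset.sum_le_sum fun i _ => ?_)
  have hs : ∀ c : ι, ‖v i c‖ ^ 2 ≤ ∑ d, ‖v i d‖ ^ 2 := fun c =>
    Finset.single_le_sum (f := fun d => ‖v i d‖ ^ 2) (fun d _ => by positivity) (Finset.mem_univ c)
  have ht : ((vecMulVec (v i) (star (v i))).trace).re = ∑ d, ‖v i d‖ ^ 2 := by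
    rw [Matrix.trace, Complex.re_sum]
    refine Finset.sum_congr rfl fun d _ => ?_
    rw [diag_apply, vecMulVec_apply, Pi.star_apply, Complex.star_def, Complex.mul_conj,
      Complex.ofReal_re, Complex.normSq_eq_norm_sq]
  rw [ht, vecMulVec_apply, Pi.star_apply, norm_mul, norm_star]
  nlinarith [hs a, hs b, sq_nonneg (‖v i a‖ - ‖v i b‖)]

end Pairing

/-! ### An informationally complete frame from polarization -/

section Frame

open Matrix

variable {B : Type*} [DecidableEq B]

/-- Labels of the vectors `|k⟩ + iᵐ|l⟩`. -/
abbrev FrameIndex (B : Type*) := B × B × Fin 4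

/-- The vector `|k⟩ + iᵐ|l⟩`. -/
def frameVec (z : FrameIndex B) : B → ℂ :=
  Pi.single z.1 1 + Complex.I ^ (z.2.2 : ℕ) • Pi.single z.2.1 1

/-- The (conjugated) projector on `frameVec`, divided by `c`. -/
def frameOp (c : ℝ) (z : FrameIndex B) : Op B :=
  ((c⁻¹ : ℝ) : ℂ) • vecMulVec (star (frameVec z)) (frameVec z)

/-- The coefficients expanding the matrix unit `|b⟩⟨b'|` in terms of the `frameOp`. -/
def frameDual (c : ℝ) (b b' : B) (z : FrameIndex B) : ℂ :=
  if z.1 = b ∧ z.2.1 = b' then (c / 4 : ℝ) * star (Complex.I ^ (z.2.2 : ℕ)) else 0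

lemma frameOp_posSemidef [Fintype B] {c : ℝ} (hc : 0 ≤ c) (z : FrameIndex B) :
    (frameOp c z).PosSemidef := by
  refine (posSemidef_vecMulVec_star_self _).smul ?_
  rw [Complex.zero_le_real]
  positivity

lemma norm_frameDual_le {c : ℝ} (hc : 0 ≤ c) (b b' : B) (z : FrameIndex B) :
    ‖frameDual c b b' z‖ ≤ c / 4 := by
  unfold frameDual
  split_ifs
  · simp [abs_of_nonneg hc]
  · simp; positivity

lemma frameOp_apply (c : ℝ) (k l : B) (m : Fin 4) (b b' : B) :
    frameOp c (k, l, m) b b' = (c : ℂ)⁻¹ *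
      (((if b = k then 1 else 0) + star (Complex.I ^ (m : ℕ)) * (if b = l then 1 else 0)) *
        ((if b' = k then 1 else 0) + Complex.I ^ (m : ℕ) * (if b' = l then 1 else 0))) := by
  simp only [frameOp, frameVec, Matrix.smul_apply, vecMulVec_apply, Pi.star_apply, Pi.add_apply,
    Pi.smul_apply, Pi.single_apply, smul_eq_mul, star_add, star_mul', Complex.ofReal_inv]
  simp only [apply_ite star, star_one, star_zero]

lemma sum_phase_mul (x y u v : ℂ) :
    ∑ m : Fin 4, (x + star (Complex.I ^ (m : ℕ)) * y) * (u + Complex.I ^ (m : ℕ) * v)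
      = 4 * (x * u + y * v) := by
  simp only [Fin.sum_univ_four, Complex.star_def, map_pow, Complex.conj_I]
  simp [pow_succ]
  linear_combination (-2 * y * v) * Complex.I_mul_I

/-- Orthogonality of the characters of the fourth roots of unity: the extra phase selects a single
cross term, as in the polarization identity. -/
lemma sum_phase_mul_mul (x y u v : ℂ) :
    ∑ m : Fin 4, star (Complex.I ^ (m : ℕ)) *
      ((x + star (Complex.I ^ (m : ℕ)) * y) * (u + Complex.I ^ (m : ℕ) * v)) = 4 * (x * v) := by
  simp only [Fin.sum_univ_four, Complex.star_def, map_pow, Complex.conj_I]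
  simp [pow_succ]
  linear_combination (-2 * x * v + 2 * y * u) * Complex.I_mul_I

/-- The phase sum cancels the cross terms with factor `4`, and each of the two diagonal terms is
counted once for every value of the other label, giving `4 * 2 * card B`. -/
lemma sum_frameOp [Fintype B] (c : ℝ) :
    ∑ z, frameOp c z = ((8 * Fintype.card B * c⁻¹ : ℝ) : ℂ) • (1 : Op B) := by
  ext b b'
  rw [Matrix.sum_apply, Fintype.sum_prod_type]
  simp_rw [Fintype.sum_prod_type, frameOp_apply, ← Finset.mul_sum, sum_phase_mul]
  simp only [← Finset.mul_sum, Finset.sum_add_distrib, Matrix.smul_apply, one_apply]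
  by_cases hb : b = b'
  · simp [hb]; ring
  · simp [hb]

lemma sum_frameDual_smul_frameOp [Fintype B] {c : ℝ} (hc : c ≠ 0) (b b' : B) :
    ∑ z, frameDual c b b' z • frameOp c z = (single b b' 1 : Op B) := by
  have hc' : (c : ℂ) ≠ 0 := by exact_mod_cast hc
  ext d d'
  rw [Matrix.sum_apply, Fintype.sum_prod_type, Finset.sum_eq_single b, Fintype.sum_prod_type,
    Finset.sum_eq_single b']
  · have : ∀ m : Fin 4, (frameDual c b b' (b, b', m) • frameOp c (b, b', m)) d d'
        = 4⁻¹ * (star (Complex.I ^ (m : ℕ)) *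
      (((if d = b then 1 else 0) + star (Complex.I ^ (m : ℕ)) * (if d = b' then 1 else 0)) *
        ((if d' = b then 1 else 0) + Complex.I ^ (m : ℕ) * (if d' = b' then 1 else 0)))) := by
      intro m
      rw [Matrix.smul_apply, frameOp_apply, smul_eq_mul, frameDual, if_pos ⟨rfl, rfl⟩]
      push_cast
      field_simp
    simp_rw [this, ← Finset.mul_sum, sum_phase_mul_mul, single_apply]
    simp only [@eq_comm _ d b, @eq_comm _ d' b']
    by_cases h1 : b = d <;> by_cases h2 : b' = d' <;> simp [h1, h2]
  · intro l _ hl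
    simp [frameDual, hl]
  · simp
  · intro k _ hk
    simp [frameDual, hk]
  · simp

end Frame

/-! ### Correcting an approximate Choi operator -/

section Repair

open Matrix
open scoped Kronecker

variable {X Y : Type*} [Fintype X] [Fintype Y] [DecidableEq X] [DecidableEq Y]

/-- The total deviation of the reduced operator on `X` from the identity. -/
def choiDefect (σ : Op (X × Y)) : ℝ :=
  ∑ x, ∑ x', ‖traceRight σ x x' - (1 : Op X) x x'‖

/-- Adjust a positive operator so that its reduced operator on `X` becomes the identity. -/
def repair (σ : Op (X × Y)) : Op (X × Y) :=
  (((1 + choiDefect σ)⁻¹ : ℝ) : ℂ) • (σ +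
    (((choiDefect σ : ℝ) : ℂ) • (1 : Op X) - (traceRight σ - 1)) ⊗ₖ
      ((((Fintype.card Y : ℝ)⁻¹ : ℝ) : ℂ) • (1 : Op Y)))

lemma choiDefect_nonneg (σ : Op (X × Y)) : 0 ≤ choiDefect σ :=
  Finset.sum_nonneg fun _ _ => Finset.sum_nonneg fun _ _ => norm_nonneg _

lemma norm_sub_one_apply_le_choiDefect (σ : Op (X × Y)) (x x' : X) :
    ‖traceRight σ x x' - (1 : Op X) x x'‖ ≤ choiDefect σ := by
  refine (Finset.single_le_sum (f := fun x' => ‖traceRight σ x x' - (1 : Op X) x x'‖)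
    (fun _ _ => norm_nonneg _) (Finset.mem_univ x')).trans ?_
  exact Finset.single_le_sum (f := fun x => ∑ x', ‖traceRight σ x x' - (1 : Op X) x x'‖)
    (fun _ _ => Finset.sum_nonneg fun _ _ => norm_nonneg _) (Finset.mem_univ x)

/-- The entrywise `ℓ¹` norm dominates the quadratic form on unit vectors. -/
lemma posSemidef_smul_one_sub {ι : Type*} [Fintype ι] [DecidableEq ι] {M : Op ι}
    (hM : M.IsHermitian) {η : ℝ} (hη : ∑ x, ∑ x', ‖M x x'‖ ≤ η) :
    ((η : ℂ) • (1 : Op ι) - M).PosSemidef := by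
  refine PosSemidef.of_dotProduct_mulVec_nonneg ?_ fun v => ?_
  · refine IsHermitian.sub ?_ hM
    rw [IsHermitian, conjTranspose_smul, conjTranspose_one]
    simp
  · have h1 : star v ⬝ᵥ v = ((∑ x, ‖v x‖ ^ 2 : ℝ) : ℂ) := by
      push_cast
      refine Finset.sum_congr rfl fun x _ => ?_
      rw [Pi.star_apply, Complex.star_def, mul_comm, Complex.mul_conj, Complex.normSq_eq_norm_sq]
      push_cast; rfl
    have him : (star v ⬝ᵥ (M *ᵥ v)).im = 0 := hM.im_star_dotProduct_mulVec_self v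
    have hnorm : ‖star v ⬝ᵥ (M *ᵥ v)‖ ≤ η * ∑ x, ‖v x‖ ^ 2 := by
      refine le_trans ?_ (mul_le_mul_of_nonneg_right hη (by positivity))
      have e : star v ⬝ᵥ (M *ᵥ v) = ∑ x, ∑ x', star (v x) * (M x x' * v x') := by
        simp only [dotProduct, mulVec, Finset.mul_sum, Pi.star_apply]
      rw [e, Finset.sum_mul]
      refine (norm_sum_le _ _).trans (Finset.sum_le_sum fun x _ => ?_)
      rw [Finset.sum_mul]
      refine (norm_sum_le _ _).trans (Finset.sum_le_sum fun x' _ => ?_)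
      rw [norm_mul, norm_mul, norm_star]
      have hs : ∀ c : ι, ‖v c‖ ^ 2 ≤ ∑ d, ‖v d‖ ^ 2 := fun c =>
        Finset.single_le_sum (f := fun d => ‖v d‖ ^ 2) (fun d _ => by positivity)
          (Finset.mem_univ c)
      have : ‖v x‖ * ‖v x'‖ ≤ ∑ d, ‖v d‖ ^ 2 := by
        nlinarith [hs x, hs x', sq_nonneg (‖v x‖ - ‖v x'‖)]
      calc _ = ‖M x x'‖ * (‖v x‖ * ‖v x'‖) := by ring
        _ ≤ _ := by gcongr
    rw [sub_mulVec, smul_mulVec, one_mulVec, dotProduct_sub, dotProduct_smul, h1,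
      Complex.nonneg_iff]
    constructor
    · rw [Complex.sub_re, smul_eq_mul, ← Complex.ofReal_mul, Complex.ofReal_re]
      linarith [(abs_le.mp ((Complex.abs_re_le_norm _).trans hnorm)).2]
    · rw [Complex.sub_im, smul_eq_mul, ← Complex.ofReal_mul, Complex.ofReal_im, him, sub_zero]

lemma traceRight_isHermitian {σ : Op (X × Y)} (hσ : σ.IsHermitian) :
    (traceRight σ).IsHermitian := by
  ext a b
  simp only [conjTranspose_apply, traceRight, of_apply, star_sum]
  exact Finset.sum_congr rfl fun y _ => hσ.apply _ _

lemma repair_posSemidef {σ : Op (X × Y)} (hσ : σ.PosSemidef) : (repair σ).PosSemidef := by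
  have h0 := choiDefect_nonneg σ
  refine PosSemidef.smul (hσ.add (PosSemidef.kronecker ?_ (PosSemidef.one.smul ?_))) ?_
  · exact posSemidef_smul_one_sub ((traceRight_isHermitian hσ.isHermitian).sub isHermitian_one)
      le_rfl
  · rw [Complex.zero_le_real]; positivity
  · rw [Complex.zero_le_real]; positivity

/-- With `τ` the reduced operator and `η` the defect, the correction gives `τ + η • 1 - (τ - 1) = (1
+ η) • 1` before normalization. The term `η • 1` keeps the correction positive. -/
lemma traceRight_repair [Nonempty Y] (σ : Op (X × Y)) : traceRight (repair σ) = 1 := by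
  have h0 := choiDefect_nonneg σ
  have hY : (Fintype.card Y : ℂ) ≠ 0 := by exact_mod_cast Fintype.card_ne_zero
  have h1 : (1 + choiDefect σ : ℂ) ≠ 0 := by
    have : (1 + choiDefect σ : ℝ) ≠ 0 := by positivity
    exact_mod_cast this
  ext x x'
  simp only [traceRight, repair, of_apply, Matrix.smul_apply, Matrix.add_apply, kroneckerMap_apply, Matrix.sub_apply,
    smul_eq_mul, one_apply_eq, ← Finset.mul_sum, Finset.sum_add_distrib]
  simp only [Finset.sum_const, Finset.card_univ, nsmul_eq_mul]
  push_cast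
  field_simp
  ring

/-- Normalization costs at most `η (d_X + η)`, since entries of `σ` are bounded by its trace, and
the correction at most `2 η`. Dividing by `1 + η` leaves a bound linear in `η` for defects of any
size. -/
lemma norm_repair_sub_le [Nonempty X] [Nonempty Y] {σ : Op (X × Y)} (hσ : σ.PosSemidef)
    (b b' : X × Y) :
    ‖repair σ b b' - σ b b'‖ ≤ (Fintype.card X + 2) * choiDefect σ := by
  have h0 := choiDefect_nonneg σ
  set η := choiDefect σ with hη
  have htr : σ.trace.re ≤ Fintype.card X + η := by
    have e : σ.trace = (Fintype.card X : ℂ) + ∑ x, (traceRight σ x x - (1 : Op X) x x) := by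
      rw [Finset.sum_sub_distrib]
      simp [Matrix.trace, traceRight, Fintype.sum_prod_type]
    rw [e]
    simp only [Complex.add_re, Complex.natCast_re]
    gcongr
    refine (Complex.re_le_norm _).trans ((norm_sum_le _ _).trans ?_)
    refine Finset.sum_le_sum fun x _ => ?_
    exact Finset.single_le_sum (f := fun x' => ‖traceRight σ x x' - (1 : Op X) x x'‖)
      (fun _ _ => norm_nonneg _) (Finset.mem_univ x)
  have h1 : ‖σ b b'‖ ≤ Fintype.card X + η := (norm_apply_le_trace hσ b b').trans htr
  have h2 : ‖((((η : ℝ) : ℂ) • (1 : Op X) - (traceRight σ - 1)) ⊗ₖ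
      ((((Fintype.card Y : ℝ)⁻¹ : ℝ) : ℂ) • (1 : Op Y))) b b'‖ ≤ 2 * η := by
    rw [kroneckerMap_apply, norm_mul]
    have ha : ‖(((η : ℝ) : ℂ) • (1 : Op X) - (traceRight σ - 1)) b.1 b'.1‖ ≤ 2 * η := by
      rw [Matrix.sub_apply, two_mul]
      refine (norm_sub_le _ _).trans (add_le_add ?_ (norm_sub_one_apply_le_choiDefect σ _ _))
      rw [Matrix.smul_apply, one_apply]
      split_ifs <;> simp [abs_of_nonneg h0, h0]
    have hb : ‖((((Fintype.card Y : ℝ)⁻¹ : ℝ) : ℂ) • (1 : Op Y)) b.2 b'.2‖ ≤ 1 := by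
      have : (1 : ℝ) ≤ Fintype.card Y := by exact_mod_cast Fintype.card_pos
      rw [Matrix.smul_apply, one_apply]
      split_ifs
      · simpa using inv_le_one_of_one_le₀ this
      · simp
    calc _ ≤ 2 * η * 1 := by gcongr
      _ = _ := mul_one _
  have hne : (1 + η : ℂ) ≠ 0 := by
    have : (1 + η : ℝ) ≠ 0 := by positivity
    exact_mod_cast this
  have e : repair σ b b' - σ b b' = (((1 + η)⁻¹ : ℝ) : ℂ) * (-(η : ℂ) * σ b b' +
      ((((η : ℝ) : ℂ) • (1 : Op X) - (traceRight σ - 1)) ⊗ₖ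
      ((((Fintype.card Y : ℝ)⁻¹ : ℝ) : ℂ) • (1 : Op Y))) b b') := by
    rw [repair, Matrix.smul_apply, Matrix.add_apply, smul_eq_mul, ← hη]
    push_cast
    field_simp
    ring
  rw [e, norm_mul, Complex.norm_real, Real.norm_of_nonneg (by positivity), ← div_eq_inv_mul,
    div_le_iff₀ (by positivity)]
  calc _ ≤ η * (Fintype.card X + η) + 2 * η := by
        refine (norm_add_le _ _).trans (add_le_add ?_ h2)
        rw [norm_mul, norm_neg, Complex.norm_real, Real.norm_of_nonneg h0]
        gcongr
    _ ≤ _ := by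
        have : (0 : ℝ) ≤ Fintype.card X := by positivity
        nlinarith [mul_nonneg this (mul_nonneg h0 h0), mul_nonneg h0 h0]

end Repair

/-! ### Outcome statistics of the frame measurement -/

section Frame

open Matrix
open scoped Kronecker

variable {A X Y : Type*} [Fintype A] [Fintype X] [Fintype Y] [DecidableEq A] [DecidableEq X]
  [DecidableEq Y] {n : ℕ}

/-- The maximally mixed state. -/
def maxMixed (X : Type*) [Fintype X] [DecidableEq X] : Op X := ((Fintype.card X : ℂ)⁻¹) • 1

lemma trace_maxMixed [Nonempty X] : (maxMixed X).trace = 1 := by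
  rw [maxMixed, trace_smul, trace_one, smul_eq_mul, inv_mul_cancel₀]
  exact_mod_cast Fintype.card_ne_zero

/-- The normalization for which the frame operators add up to the maximally mixed state on `X`
tensored with the identity on `Y`. -/
def frameConst (X Y : Type*) [Fintype X] [Fintype Y] : ℝ :=
  8 * Fintype.card (X × Y) * Fintype.card X

lemma frameConst_pos [Nonempty X] [Nonempty Y] : 0 < frameConst X Y := by
  unfold frameConst
  positivity

lemma sum_frameOp_frameConst [Nonempty X] [Nonempty Y] :
    ∑ z, frameOp (frameConst X Y) z = maxMixed X ⊗ₖ (1 : Op Y) := by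
  rw [sum_frameOp, maxMixed, smul_kronecker, one_kronecker_one]
  congr 1
  have : (Fintype.card (X × Y) : ℂ) ≠ 0 := by exact_mod_cast Fintype.card_ne_zero
  unfold frameConst
  push_cast
  field_simp

/-- The effect on `A` for the outcomes `z` of measuring the frame on every register. -/
def frameEffect (K : Op (A × (Fin n → X × Y))) (z : Fin n → FrameIndex (X × Y)) : Op A :=
  effect K fun i => frameOp (frameConst X Y) (z i)

/-- The weight of the outcomes `z` when `A` is traced out. -/
def frameWeight (K : Op (A × (Fin n → X × Y))) (z : Fin n → FrameIndex (X × Y)) : ℝ :=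
  (frameEffect K z).trace.re

/-- `K` is the kernel of a trace preserving map. -/
def IsTracePreservingKernel (K : Op (A × (Fin n → X × Y))) : Prop :=
  ∀ (R : Op A) (N : Fin n → Op X),
    pairing K R (fun i => N i ⊗ₖ (1 : Op Y)) = R.trace * ∏ i, (N i).trace

variable {K : Op (A × (Fin n → X × Y))} [Nonempty X] [Nonempty Y]

lemma frameEffect_posSemidef (hK : K.PosSemidef) (z : Fin n → FrameIndex (X × Y)) :
    (frameEffect K z).PosSemidef :=
  effect_posSemidef hK fun i => frameOp_posSemidef frameConst_pos.le (z i)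

lemma ofReal_frameWeight (hK : K.PosSemidef) (z : Fin n → FrameIndex (X × Y)) :
    (frameWeight K z : ℂ) = pairing K 1 fun i => frameOp (frameConst X Y) (z i) := by
  have h := (frameEffect_posSemidef hK z).trace_nonneg
  rw [← effect_trace]
  exact Complex.ext (by simp [frameWeight, frameEffect])
    (by simpa [frameEffect] using (Complex.nonneg_iff.mp h).2)

lemma frameWeight_nonneg (hK : K.PosSemidef) (z : Fin n → FrameIndex (X × Y)) :
    0 ≤ frameWeight K z :=
  (Complex.nonneg_iff.mp (frameEffect_posSemidef hK z).trace_nonneg).1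

lemma sum_frameEffect (hTP : IsTracePreservingKernel K) :
    ∑ z, frameEffect K z = 1 := by
  ext a' a
  have := sum_prod_mul_pairing K (single a a' 1) (frameOp (frameConst X Y)) (fun _ _ => 1)
  simp only [Finset.prod_const_one, one_mul, one_smul, sum_frameOp_frameConst] at this
  rw [Matrix.sum_apply]
  simp only [frameEffect, effect, of_apply]
  rw [this, hTP]
  simp only [trace_maxMixed, Finset.prod_const_one, mul_one]
  rw [one_apply]
  split_ifs with h
  · simp [h]
  · rw [trace_single_eq_of_ne _ _ _ (Ne.symm h)]

lemma sum_frameWeight (hTP : IsTracePreservingKernel K) :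
    ∑ z, frameWeight K z = Fintype.card A := by
  unfold frameWeight
  rw [← Complex.re_sum, ← trace_sum, sum_frameEffect hTP]
  simp

/-- Weighting by the dual at register `i` rebuilds a matrix unit there. Summing freely over the
other outcomes leaves maximally mixed inputs and traced-out outputs. -/
lemma sum_frameEffect_mul_frameDual (a a' : A) (b b' : X × Y) (i : Fin n) :
    ∑ z, frameEffect K z a' a * frameDual (frameConst X Y) b b' (z i)
      = pairing K (single a a' 1)
        (Function.update (fun _ => maxMixed X ⊗ₖ (1 : Op Y)) i (single b b' 1)) := by
  have := sum_prod_mul_pairing K (single a a' 1) (frameOp (frameConst X Y))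
    (fun k w => if k = i then frameDual (frameConst X Y) b b' w else 1)
  convert this using 1
  · refine Finset.sum_congr rfl fun z _ => ?_
    rw [mul_comm, Finset.prod_ite_eq' Finset.univ i, if_pos (Finset.mem_univ i)]
    rfl
  · congr 1
    funext k
    rcases eq_or_ne k i with rfl | hk
    · simp [sum_frameDual_smul_frameOp frameConst_pos.ne']
    · simp [hk, sum_frameOp_frameConst]

/-- The coefficients of the reduced matrix unit `|x⟩⟨x'|`, centred. -/
def centredDual (Y : Type*) [Fintype Y] [DecidableEq Y] (x x' : X) (w : FrameIndex (X × Y)) : ℂ :=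
  ∑ y, frameDual (frameConst X Y) (x, y) (x', y) w - (1 : Op X) x x'

lemma sum_single_eq_kronecker (x x' : X) :
    ∑ y : Y, single (x, y) (x', y) (1 : ℂ) = single x x' 1 ⊗ₖ (1 : Op Y) := by
  ext ⟨p, q⟩ ⟨p', q'⟩
  rw [Matrix.sum_apply, kroneckerMap_apply, one_apply]
  simp only [single_apply, Prod.mk.injEq]
  by_cases h : q = q'
  · subst h
    rw [Finset.sum_eq_single q] <;> simp +contextual
  · rw [if_neg h, mul_zero]
    refine Finset.sum_eq_zero fun y _ => ?_
    grind

lemma sum_centredDual_smul (x x' : X) :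
    ∑ w, centredDual Y x x' w • frameOp (frameConst X Y) w
      = (single x x' 1 - (1 : Op X) x x' • maxMixed X) ⊗ₖ (1 : Op Y) := by
  simp only [centredDual, sub_smul, Finset.sum_sub_distrib, Finset.sum_smul, ← Finset.smul_sum,
    sum_frameOp_frameConst]
  rw [Finset.sum_comm]
  simp_rw [sum_frameDual_smul_frameOp (frameConst_pos (X := X) (Y := Y)).ne']
  rw [sum_single_eq_kronecker]
  ext p q
  simp only [Matrix.sub_apply, kroneckerMap_apply, Matrix.smul_apply, smul_eq_mul]
  ring

lemma sum_star_centredDual_smul (x x' : X) :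
    ∑ w, star (centredDual Y x x' w) • frameOp (frameConst X Y) w
      = (single x x' 1 - (1 : Op X) x x' • maxMixed X)ᴴ ⊗ₖ (1 : Op Y) := by
  have h := congrArg conjTranspose (sum_centredDual_smul (Y := Y) x x')
  rw [conjTranspose_kronecker, conjTranspose_one] at h
  rw [← h, conjTranspose_sum]
  refine Finset.sum_congr rfl fun w _ => ?_
  rw [conjTranspose_smul, (frameOp_posSemidef frameConst_pos.le w).isHermitian.eq]

/-- The centred coefficients act on the input alone, so trace preservation factorizes the
correlation into a product of traces, and the slot `i` operator has trace zero. -/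
lemma sum_frameWeight_mul_centredDual (hK : K.PosSemidef) (hTP : IsTracePreservingKernel K)
    (x x' : X) {i j : Fin n} (hij : i ≠ j) :
    ∑ z, (frameWeight K z : ℂ) * (centredDual Y x x' (z i) * star (centredDual Y x x' (z j)))
      = 0 := by
  set N := single x x' (1 : ℂ) - (1 : Op X) x x' • maxMixed X with hN
  have htr : N.trace = 0 := by
    rw [hN, trace_sub, trace_smul, trace_maxMixed, one_apply]
    split_ifs with h
    · simp [h]
    · simp [trace_single_eq_of_ne _ _ _ h]
  have := sum_prod_mul_pairing K 1 (frameOp (frameConst X Y))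
    (fun k w => (if k = i then centredDual Y x x' w else 1) *
      (if k = j then star (centredDual Y x x' w) else 1))
  have hslot : (fun k : Fin n => ∑ w, ((if k = i then centredDual Y x x' w else 1) *
      (if k = j then star (centredDual Y x x' w) else 1)) • frameOp (frameConst X Y) w)
      = fun k => (if k = i then N else if k = j then Nᴴ else maxMixed X) ⊗ₖ (1 : Op Y) := by
    funext k
    by_cases hi : k = i
    · subst hi
      simp [hij, sum_centredDual_smul, hN]
    · by_cases hj : k = j
      · subst hj
        simp only [hi, if_false, if_true, one_mul]
        exact sum_star_centredDual_smul x x'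
      · simp [hi, hj, sum_frameOp_frameConst]
  rw [hslot, hTP, Finset.prod_eq_zero (Finset.mem_univ i) (by simp [htr]), mul_zero] at this
  rw [← this]
  refine Finset.sum_congr rfl fun z _ => ?_
  rw [ofReal_frameWeight hK, mul_comm, Finset.prod_mul_distrib]
  congr 1
  rw [Finset.prod_ite_eq' Finset.univ i, if_pos (Finset.mem_univ i),
    Finset.prod_ite_eq' Finset.univ j, if_pos (Finset.mem_univ j)]

lemma norm_sum_frameDual_le (x x' : X) (w : FrameIndex (X × Y)) :
    ‖∑ y, frameDual (frameConst X Y) (x, y) (x', y) w‖ ≤ Fintype.card Y * frameConst X Y := by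
  have hc := frameConst_pos (X := X) (Y := Y)
  refine (norm_sum_le _ _).trans ?_
  refine (Finset.sum_le_sum fun y _ => norm_frameDual_le hc.le _ _ _).trans ?_
  rw [Finset.sum_const, Finset.card_univ, nsmul_eq_mul]
  gcongr
  linarith

lemma norm_centredDual_le (x x' : X) (w : FrameIndex (X × Y)) :
    ‖centredDual Y x x' w‖ ≤ Fintype.card Y * frameConst X Y + 1 := by
  refine (norm_sub_le _ _).trans (add_le_add (norm_sum_frameDual_le x x' w) ?_)
  rw [one_apply]
  split_ifs <;> simp

/-- The outcomes of the registers selected by `s`. -/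
def revealed {Z : Type*} (s : Fin n → Bool) (z : Fin n → Z) : Fin n → Option Z :=
  fun i => if s i then some (z i) else none

lemma revealed_eq_iff {Z : Type*} (s : Fin n → Bool) (z z' : Fin n → Z) :
    revealed s z' = revealed s z ↔ ∀ i, s i → z' i = z i := by
  simp only [revealed, funext_iff]
  refine forall_congr' fun i => ?_
  cases s i <;> simp

/-- Conditionally on the outcomes of the other revealed registers, an unrevealed register carries
a positive operator. -/
lemma sum_fiber_mul_frameDual_nonneg (hK : K.PosSemidef) (s : Fin n → Bool)
    (z : Fin n → FrameIndex (X × Y)) {i : Fin n} (hi : s i = false) (v : X × Y → ℂ) :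
    0 ≤ ∑ z', if revealed s z' = revealed s z then (frameWeight K z' : ℂ) *
      ∑ b, ∑ b', star (v b) * v b' * frameDual (frameConst X Y) b b' (z' i) else 0 := by
  -- The fibre condition is a product of indicators over revealed registers. As `i` is unrevealed,
  -- slot `i` receives only the quadratic form, which becomes a rank-one positive operator; every
  -- other slot is a nonnegative combination of frame operators.
  have := sum_prod_mul_pairing K 1 (frameOp (frameConst X Y))
    (fun k w => (if k = i then
      ∑ b, ∑ b', star (v b) * v b' * frameDual (frameConst X Y) b b' w else 1) *
      (if s k then if w = z k then 1 else 0 else 1))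
  have hE : ∑ w, (∑ b, ∑ b', star (v b) * v b' * frameDual (frameConst X Y) b b' w) •
      frameOp (frameConst X Y) w = vecMulVec (star v) v := by
    simp_rw [Finset.sum_smul, mul_smul]
    rw [Finset.sum_comm]
    simp_rw [Finset.sum_comm (s := (Finset.univ : Finset (FrameIndex (X × Y))))]
    simp_rw [← Finset.smul_sum,
      sum_frameDual_smul_frameOp (frameConst_pos (X := X) (Y := Y)).ne']
    ext p q
    simp [Matrix.sum_apply, single_apply, vecMulVec_apply, ite_and]
  have hpos : 0 ≤ pairing K 1 (fun k => ∑ w, ((if k = i then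
      ∑ b, ∑ b', star (v b) * v b' * frameDual (frameConst X Y) b b' w else 1) *
      (if s k then if w = z k then 1 else 0 else 1)) • frameOp (frameConst X Y) w) := by
    refine pairing_nonneg hK PosSemidef.one fun k => ?_
    by_cases hk : k = i
    · subst hk
      simp only [if_true, hi, Bool.false_eq_true, if_false, mul_one, hE]
      exact posSemidef_vecMulVec_star_self v
    · simp only [hk, if_false, one_mul]
      refine posSemidef_sum _ fun w _ => (frameOp_posSemidef frameConst_pos.le w).smul ?_
      split_ifs <;> simp
  rw [← this] at hpos
  convert hpos using 1
  refine Finset.sum_congr rfl fun z' _ => ?_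
  rw [ofReal_frameWeight hK, Finset.prod_mul_distrib, Finset.prod_ite_eq' Finset.univ i,
    if_pos (Finset.mem_univ i)]
  have hp : (∏ k, if s k then if z' k = z k then (1 : ℂ) else 0 else 1)
      = if revealed s z' = revealed s z then 1 else 0 := by
    have : ∀ k, (if s k then if z' k = z k then (1 : ℂ) else 0 else 1)
        = if s k → z' k = z k then 1 else 0 := by
      intro k
      by_cases h1 : s k <;> simp [h1]
    simp_rw [this, Finset.prod_ite_zero, Finset.prod_const_one, revealed_eq_iff]
    simp
  rw [hp]
  split_ifs <;> ring

end Frame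

/-! ### Random splitting into revealed and unrevealed registers -/

section Splitting

variable {Z : Type*} {n : ℕ}

/-- The sign attached to a revealed or unrevealed register. -/
def splitSign (b : Bool) : ℂ := if b then -1 else 1

/-- Average of `f` over the registers. -/
def average (f : Z → ℂ) (z : Fin n → Z) : ℂ := (n : ℂ)⁻¹ * ∑ i, f (z i)

/-- Signed average of `f` over the registers. -/
def signedAverage (f : Z → ℂ) (s : Fin n → Bool) (z : Fin n → Z) : ℂ :=
  (n : ℂ)⁻¹ * ∑ i, splitSign (s i) * f (z i)

lemma norm_splitSign (b : Bool) : ‖splitSign b‖ = 1 := by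
  cases b <;> simp [splitSign]

lemma sum_splitSign : ∑ b, splitSign b = 0 := by
  simp [splitSign]

/-- The coefficient is `2` on unrevealed registers and `0` on revealed ones; the difference below
has these roles exchanged. -/
lemma average_add_signedAverage (f : Z → ℂ) (s : Fin n → Bool) (z : Fin n → Z) :
    average f z + signedAverage f s z = (n : ℂ)⁻¹ * ∑ i, (1 + splitSign (s i)) * f (z i) := by
  simp only [average, signedAverage, add_mul, one_mul, Finset.sum_add_distrib, mul_add]

lemma average_sub_signedAverage (f : Z → ℂ) (s : Fin n → Bool) (z : Fin n → Z) :
    average f z - signedAverage f s z = (n : ℂ)⁻¹ * ∑ i, (1 - splitSign (s i)) * f (z i) := by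
  simp only [average, signedAverage, sub_mul, one_mul, Finset.sum_sub_distrib, mul_sub]

lemma sum_signedAverage (f : Z → ℂ) (z : Fin n → Z) : ∑ s, signedAverage f s z = 0 := by
  simp only [signedAverage, ← Finset.mul_sum]
  rw [Finset.sum_comm]
  refine mul_eq_zero_of_right _ (Finset.sum_eq_zero fun i _ => ?_)
  rw [← Finset.sum_mul]
  have : ∀ s : Fin n → Bool, splitSign (s i) = ∏ k, if k = i then splitSign (s k) else 1 := by
    intro s; simp
  simp_rw [this]
  rw [← Fintype.prod_sum (f := fun k w => if k = i then splitSign w else 1),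
    Finset.prod_eq_zero (Finset.mem_univ i) (by simp only [if_true]; exact sum_splitSign),
    zero_mul]

lemma sum_norm_signedAverage_le (hn : 1 ≤ n) {f : Z → ℂ} {H : ℝ} (hf : ∀ w, ‖f w‖ ≤ H)
    (z : Fin n → Z) : ∑ s, ‖signedAverage f s z‖ ≤ H * 2 ^ n / √n := by
  have := sum_mul_norm_average_le hn (fun _ : Fin n → Bool => (1 : ℝ)) (fun _ => zero_le_one)
    (fun i s => splitSign (s i) * f (z i)) (H := H)
    (fun i s => by rw [norm_mul, norm_splitSign, one_mul]; exact hf _)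
    (fun i j hij => by
      have h := sum_apply_mul_apply_eq_zero splitSign sum_splitSign hij
      calc _ = ∑ s : Fin n → Bool, (splitSign (s i) * star (splitSign (s j))) *
              (f (z i) * star (f (z j))) := by
            refine Finset.sum_congr rfl fun s _ => ?_
            rw [star_mul']; push_cast; ring
        _ = 0 := by rw [← Finset.sum_mul, h, zero_mul])
  simpa [signedAverage] using this

variable [Fintype Z] [DecidableEq Z]

/-- Writing `U` and `V` for the unrevealed and revealed averages, `V` is fixed by conditioning and
`U - V` is twice the signed average. Hence `U - E[U]` equals `(U - V) - E[U - V]`, and contraction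
gives the factor `2 + 2`. -/
lemma sum_mul_norm_sub_condMean_le (p : (Fin n → Z) → ℝ) (hp : ∀ z, 0 ≤ p z) (f : Z → ℂ)
    (s : Fin n → Bool) :
    ∑ z, p z * ‖average f z + signedAverage f s z -
      condMean p (revealed s) (fun z' => average f z' + signedAverage f s z') z‖
      ≤ 4 * ∑ z, p z * ‖signedAverage f s z‖ := by
  have hmeas := mul_condMean_of_measurable p hp (revealed s)
    (fun z => average f z - signedAverage f s z) (by
      intro z z' h
      rw [revealed_eq_iff] at h
      simp only [average_sub_signedAverage]
      congr 1
      refine Finset.sum_congr rfl fun i _ => ?_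
      cases hs : s i
      · simp [splitSign]
      · rw [h i hs])
  have hpt : ∀ z, p z * ‖average f z + signedAverage f s z -
      condMean p (revealed s) (fun z' => average f z' + signedAverage f s z') z‖
      ≤ 2 * (p z * ‖signedAverage f s z‖) +
        p z * ‖condMean p (revealed s) (fun z' => 2 * signedAverage f s z') z‖ := by
    intro z
    have hsub := condMean_sub p (revealed s) (fun z' => average f z' + signedAverage f s z')
      (fun z' => average f z' - signedAverage f s z') z
    have e1 : (fun z' => average f z' + signedAverage f s z' -
        (average f z' - signedAverage f s z')) = fun z' => 2 * signedAverage f s z' := by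
      funext z'; ring
    rw [e1] at hsub
    have e : (p z : ℂ) * (average f z + signedAverage f s z -
        condMean p (revealed s) (fun z' => average f z' + signedAverage f s z') z)
        = p z * (2 * signedAverage f s z) -
          p z * condMean p (revealed s) (fun z' => 2 * signedAverage f s z') z := by
      rw [hsub]
      linear_combination -hmeas z
    have hn : ∀ w : ℂ, p z * ‖w‖ = ‖(p z : ℂ) * w‖ := fun w => by
      rw [norm_mul, Complex.norm_real, Real.norm_of_nonneg (hp z)]
    rw [hn, hn, hn, e]
    refine (norm_sub_le _ _).trans (add_le_add (le_of_eq ?_) le_rfl)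
    simp only [norm_mul]
    norm_num
    ring
  refine (Finset.sum_le_sum fun z _ => hpt z).trans ?_
  rw [Finset.sum_add_distrib, ← Finset.mul_sum]
  have h2 := sum_mul_norm_condMean_le p hp (revealed s) (fun z' => 2 * signedAverage f s z')
  have h3 : ∑ z, p z * ‖2 * signedAverage f s z‖ = 2 * ∑ z, p z * ‖signedAverage f s z‖ := by
    rw [Finset.mul_sum]
    refine Finset.sum_congr rfl fun z _ => ?_
    rw [norm_mul]; norm_num; ring
  linarith

end Splitting

/-! ### The conditional operators: positivity and defect -/

section DeFinetti

open Matrix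
open scoped Kronecker

variable {A X Y : Type*} [Fintype A] [Fintype X] [Fintype Y] [DecidableEq A] [DecidableEq X]
  [DecidableEq Y] {n : ℕ} {K : Op (A × (Fin n → X × Y))} [Nonempty X] [Nonempty Y]

/-- The average conditional operator on the registers left unrevealed by `s`. -/
def condOp (K : Op (A × (Fin n → X × Y))) (s : Fin n → Bool) (z : Fin n → FrameIndex (X × Y)) :
    Op (X × Y) :=
  Matrix.of fun b b' => condMean (frameWeight K) (revealed s)
    (fun z' => average (frameDual (frameConst X Y) b b') z' +
      signedAverage (frameDual (frameConst X Y) b b') s z') z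

lemma condOp_posSemidef (hK : K.PosSemidef) (s : Fin n → Bool)
    (z : Fin n → FrameIndex (X × Y)) : (condOp K s z).PosSemidef := by
  refine posSemidef_of_nonneg _ fun v => ?_
  have e : star v ⬝ᵥ (condOp K s z *ᵥ v)
      = (((∑ z', if revealed s z' = revealed s z then frameWeight K z' else 0)⁻¹ : ℝ) : ℂ) *
        ((n : ℂ)⁻¹ * ∑ i, (1 + splitSign (s i)) *
          ∑ z', if revealed s z' = revealed s z then (frameWeight K z' : ℂ) *
            ∑ b, ∑ b', star (v b) * v b' * frameDual (frameConst X Y) b b' (z' i) else 0) := by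
    have e1 : star v ⬝ᵥ (condOp K s z *ᵥ v) = ∑ b, ∑ b', star (v b) * v b' *
        condOp K s z b b' := by
      simp only [dotProduct, mulVec, Finset.mul_sum, Pi.star_apply]
      exact Finset.sum_congr rfl fun b _ => Finset.sum_congr rfl fun b' _ => by ring
    rw [e1]
    simp only [condOp, of_apply, ← condMean_const_mul, ← condMean_sum]
    rw [condMean, div_eq_inv_mul, Complex.ofReal_inv]
    congr 1
    simp_rw [Finset.mul_sum (s := (Finset.univ : Finset (Fin n)))]
    simp_rw [Finset.mul_sum (s := (Finset.univ : Finset (Fin n → FrameIndex (X × Y))))]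
    rw [Finset.sum_comm]
    refine Finset.sum_congr rfl fun z' _ => ?_
    split_ifs
    · simp only [average_add_signedAverage, Finset.mul_sum]
      simp_rw [Finset.sum_comm (t := (Finset.univ : Finset (Fin n)))]
      refine Finset.sum_congr rfl fun i _ => Finset.sum_congr rfl fun b _ =>
        Finset.sum_congr rfl fun b' _ => ?_
      ring
    · simp
  rw [e]
  refine mul_nonneg ?_ (mul_nonneg ?_ (Finset.sum_nonneg fun i _ => ?_))
  · rw [Complex.zero_le_real]
    exact inv_nonneg.mpr ((frameWeight_nonneg hK z).trans
      (weight_le_fiber _ (frameWeight_nonneg hK) _ z))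
  · rw [Complex.nonneg_iff]; simp
  · cases hs : s i
    · refine mul_nonneg ?_ (sum_fiber_mul_frameDual_nonneg hK s z hs v)
      rw [splitSign]
      simp
      norm_num [Complex.nonneg_iff]
    · simp [splitSign]

lemma traceRight_condOp (s : Fin n → Bool) (z : Fin n → FrameIndex (X × Y)) (x x' : X) :
    traceRight (condOp K s z) x x' = condMean (frameWeight K) (revealed s)
      (fun z' => average (fun w => ∑ y, frameDual (frameConst X Y) (x, y) (x', y) w) z' +
        signedAverage (fun w => ∑ y, frameDual (frameConst X Y) (x, y) (x', y) w) s z') z := by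
  simp only [traceRight, condOp, of_apply]
  rw [← condMean_sum]
  congr 1
  funext z'
  rw [Finset.sum_add_distrib]
  simp only [average, signedAverage, Finset.mul_sum]
  congr 1
  · rw [Finset.sum_comm]
  · rw [Finset.sum_comm]

/-- Each defect entry is the conditional mean of a centred empirical average plus a signed average.
Contraction removes the conditioning, and the uncorrelated centred part is bounded by its second
moment. -/
lemma sum_mul_choiDefect_le (hn : 1 ≤ n) (hK : K.PosSemidef) (hTP : IsTracePreservingKernel K)
    (s : Fin n → Bool) :
    ∑ z, frameWeight K z * choiDefect (condOp K s z) ≤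
      ∑ x : X, ∑ x' : X, ((Fintype.card Y * frameConst X Y + 1) * Fintype.card A / √n +
        ∑ z, frameWeight K z * ‖signedAverage
          (fun w => ∑ y, frameDual (frameConst X Y) (x, y) (x', y) w) s z‖) := by
  simp only [choiDefect, Finset.mul_sum]
  rw [Finset.sum_comm]
  refine Finset.sum_le_sum fun x _ => ?_
  rw [Finset.sum_comm]
  refine Finset.sum_le_sum fun x' _ => ?_
  set p := frameWeight K
  have hp : ∀ z, 0 ≤ p z := frameWeight_nonneg hK
  set g : FrameIndex (X × Y) → ℂ := fun w => ∑ y, frameDual (frameConst X Y) (x, y) (x', y) w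
  have hn0 : (n : ℂ) ≠ 0 := by exact_mod_cast (by omega : n ≠ 0)
  have havg : ∀ z : Fin n → FrameIndex (X × Y),
      average g z - (1 : Op X) x x' = average (centredDual Y x x') z := by
    intro z
    simp only [average, centredDual, Finset.sum_sub_distrib, g]
    simp [mul_sub, hn0]
  have hcentred : ∑ z, p z * ‖average (centredDual Y x x') z‖
      ≤ (Fintype.card Y * frameConst X Y + 1) * Fintype.card A / √n := by
    have := sum_mul_norm_average_le hn p hp (fun i z => centredDual Y x x' (z i))
      (fun i z => norm_centredDual_le x x' (z i))
      (fun i j hij => sum_frameWeight_mul_centredDual hK hTP x x' hij)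
    rwa [sum_frameWeight hTP] at this
  have hconst : ∀ z, p z * ‖traceRight (condOp K s z) x x' - (1 : Op X) x x'‖
      = p z * ‖condMean p (revealed s)
        (fun z' => average (centredDual Y x x') z' + signedAverage g s z') z‖ := by
    intro z
    have h1 := mul_condMean_of_measurable p hp (revealed s) (fun _ => (1 : Op X) x x')
      (fun _ _ _ => rfl) z
    have h2 := condMean_sub p (revealed s) (fun z' => average g z' + signedAverage g s z')
      (fun _ => (1 : Op X) x x') z
    have e1 : (fun z' => average g z' + signedAverage g s z' - (1 : Op X) x x')
        = fun z' => average (centredDual Y x x') z' + signedAverage g s z' := by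
      funext z'
      rw [← havg]; ring
    rw [e1] at h2
    have hnm : ∀ w : ℂ, p z * ‖w‖ = ‖(p z : ℂ) * w‖ := fun w => by
      rw [norm_mul, Complex.norm_real, Real.norm_of_nonneg (hp z)]
    rw [hnm, hnm, h2, traceRight_condOp, mul_sub, mul_sub, h1]
  calc _ = ∑ z, p z * ‖condMean p (revealed s)
        (fun z' => average (centredDual Y x x') z' + signedAverage g s z') z‖ :=
        Finset.sum_congr rfl fun z _ => hconst z
    _ ≤ ∑ z, p z * ‖average (centredDual Y x x') z + signedAverage g s z‖ :=
        sum_mul_norm_condMean_le p hp _ _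
    _ ≤ ∑ z, (p z * ‖average (centredDual Y x x') z‖ + p z * ‖signedAverage g s z‖) := by
        refine Finset.sum_le_sum fun z _ => ?_
        rw [← mul_add]
        exact mul_le_mul_of_nonneg_left (norm_add_le _ _) (hp z)
    _ ≤ _ := by
        rw [Finset.sum_add_distrib]
        gcongr

/-- The constant in the approximation of the averaged marginal. -/
def approxConst (A X Y : Type*) [Fintype A] [Fintype X] [Fintype Y] : ℝ :=
  (4 * frameConst X Y + (Fintype.card X + 2) * (Fintype.card X ^ 2 *
    (2 * (Fintype.card Y * frameConst X Y) + 1))) * Fintype.card A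

end DeFinetti

/-! ### The averaged marginal is nearly separable -/

section DeFinetti

open Matrix
open scoped Kronecker

variable {A X Y : Type*} [Fintype A] [Fintype X] [Fintype Y] [DecidableEq A] [DecidableEq X]
  [DecidableEq Y] {n : ℕ} {K : Op (A × (Fin n → X × Y))} [Nonempty X] [Nonempty Y]

/-- The averaged marginal of a trace preserving kernel is close to a separable one. -/
lemma norm_average_pairing_sub_le (hn : 1 ≤ n) (hK : K.PosSemidef)
    (hTP : IsTracePreservingKernel K) (a a' : A) (b b' : X × Y) :
    ‖(n : ℂ)⁻¹ * ∑ i, pairing K (single a a' 1)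
        (Function.update (fun _ => maxMixed X ⊗ₖ (1 : Op Y)) i (single b b' 1)) -
      ∑ g : (Fin n → Bool) × (Fin n → FrameIndex (X × Y)),
        (2 ^ n : ℂ)⁻¹ * frameEffect K g.2 a' a * repair (condOp K g.1 g.2) b b'‖
      ≤ approxConst A X Y / √n := by
  set D := frameDual (frameConst X Y) b b' with hD
  set c := frameConst X Y with hc
  have hc0 : 0 < c := frameConst_pos
  set p := frameWeight K
  have hp : ∀ z, 0 ≤ p z := frameWeight_nonneg hK
  have hsq : 0 < √(n : ℝ) := Real.sqrt_pos.mpr (by exact_mod_cast hn)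
  -- The signed average vanishes on summing over `s`, so it can be added without changing the
  -- averaged marginal.
  have hfirst : (n : ℂ)⁻¹ * ∑ i, pairing K (single a a' 1)
      (Function.update (fun _ => maxMixed X ⊗ₖ (1 : Op Y)) i (single b b' 1))
      = ∑ s : Fin n → Bool, ∑ z, (2 ^ n : ℂ)⁻¹ * frameEffect K z a' a *
          (average D z + signedAverage D s z) := by
    rw [Finset.sum_comm]
    simp_rw [← Finset.mul_sum, Finset.sum_add_distrib, sum_signedAverage, add_zero,
      ← sum_frameEffect_mul_frameDual]
    rw [Finset.sum_comm]
    simp_rw [← Finset.mul_sum]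
    rw [Finset.mul_sum]
    refine Finset.sum_congr rfl fun z _ => ?_
    rw [average, Finset.sum_const, Finset.card_univ]
    simp
    field_simp
    rfl
  rw [hfirst, Fintype.sum_prod_type, ← Finset.sum_sub_distrib]
  simp_rw [← Finset.sum_sub_distrib, ← mul_sub]
  have hterm : ∀ (s : Fin n → Bool) (z : Fin n → FrameIndex (X × Y)),
      ‖(2 ^ n : ℂ)⁻¹ * frameEffect K z a' a *
        (average D z + signedAverage D s z - repair (condOp K s z) b b')‖
      ≤ (2 ^ n : ℝ)⁻¹ * (p z * ‖average D z + signedAverage D s z - condOp K s z b b'‖ +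
        (Fintype.card X + 2) * (p z * choiDefect (condOp K s z))) := by
    intro s z
    have h1 := norm_apply_le_trace (frameEffect_posSemidef hK z) a' a
    have h2 := norm_repair_sub_le (condOp_posSemidef hK s z) b b'
    have h3 : ‖average D z + signedAverage D s z - repair (condOp K s z) b b'‖ ≤
        ‖average D z + signedAverage D s z - condOp K s z b b'‖ +
          (Fintype.card X + 2) * choiDefect (condOp K s z) := by
      refine le_trans ?_ (add_le_add_right h2 _)
      rw [norm_sub_rev (repair _ _ _)]
      exact norm_sub_le_norm_sub_add_norm_sub _ _ _
    rw [norm_mul, norm_mul, mul_assoc]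
    have h4 : ‖(2 ^ n : ℂ)⁻¹‖ = (2 ^ n : ℝ)⁻¹ := by simp
    rw [h4]
    refine mul_le_mul_of_nonneg_left ?_ (by positivity)
    calc _ ≤ p z * (‖average D z + signedAverage D s z - condOp K s z b b'‖ +
          (Fintype.card X + 2) * choiDefect (condOp K s z)) :=
          mul_le_mul h1 h3 (norm_nonneg _) (hp z)
      _ = _ := by ring
  have hDbound : ∀ w, ‖D w‖ ≤ c := fun w =>
    (norm_frameDual_le hc0.le b b' w).trans (by linarith)
  have hsigned : ∀ (f : FrameIndex (X × Y) → ℂ) (H : ℝ), (∀ w, ‖f w‖ ≤ H) →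
      ∑ s : Fin n → Bool, ∑ z, p z * ‖signedAverage f s z‖
        ≤ 2 ^ n * (H * Fintype.card A / √n) := by
    intro f H hf
    rw [Finset.sum_comm]
    simp_rw [← Finset.mul_sum]
    calc _ ≤ ∑ z, p z * (H * 2 ^ n / √n) := Finset.sum_le_sum fun z _ =>
          mul_le_mul_of_nonneg_left (sum_norm_signedAverage_le hn hf z) (hp z)
      _ = _ := by
          rw [← Finset.sum_mul, sum_frameWeight hTP]
          ring
  have hA : ∑ s : Fin n → Bool, ∑ z,
      p z * ‖average D z + signedAverage D s z - condOp K s z b b'‖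
      ≤ 2 ^ n * (4 * c * Fintype.card A / √n) := by
    calc _ ≤ ∑ s : Fin n → Bool, 4 * ∑ z, p z * ‖signedAverage D s z‖ :=
          Finset.sum_le_sum fun s _ => sum_mul_norm_sub_condMean_le p hp D s
      _ ≤ 4 * (2 ^ n * (c * Fintype.card A / √n)) := by
          rw [← Finset.mul_sum]
          exact mul_le_mul_of_nonneg_left (hsigned D c hDbound) (by norm_num)
      _ = _ := by ring
  -- Each of the `d_X ^ 2` entries contributes `d_Y c + 1` from the centred average and `d_Y c` from
  -- the signed one.
  have hB : ∑ s : Fin n → Bool, ∑ z, p z * choiDefect (condOp K s z)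
      ≤ 2 ^ n * ((Fintype.card X ^ 2 * (2 * (Fintype.card Y * c) + 1)) *
        Fintype.card A / √n) := by
    calc _ ≤ ∑ s : Fin n → Bool, ∑ x : X, ∑ x' : X,
          ((Fintype.card Y * c + 1) * Fintype.card A / √n + ∑ z, p z * ‖signedAverage
            (fun w => ∑ y, frameDual c (x, y) (x', y) w) s z‖) :=
          Finset.sum_le_sum fun s _ => sum_mul_choiDefect_le hn hK hTP s
      _ = ∑ x : X, ∑ x' : X, ∑ s : Fin n → Bool,
          ((Fintype.card Y * c + 1) * Fintype.card A / √n + ∑ z, p z * ‖signedAverage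
            (fun w => ∑ y, frameDual c (x, y) (x', y) w) s z‖) := by
          rw [Finset.sum_comm]
          refine Finset.sum_congr rfl fun x _ => ?_
          rw [Finset.sum_comm]
      _ ≤ ∑ _x : X, ∑ _x' : X, (2 ^ n * ((Fintype.card Y * c + 1) * Fintype.card A / √n) +
          2 ^ n * ((Fintype.card Y * c) * Fintype.card A / √n)) := by
          refine Finset.sum_le_sum fun x _ => Finset.sum_le_sum fun x' _ => ?_
          rw [Finset.sum_add_distrib]
          refine add_le_add (le_of_eq ?_) (hsigned _ _ fun w => norm_sum_frameDual_le x x' w)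
          rw [Finset.sum_const, Finset.card_univ]
          simp
      _ = _ := by
          simp only [Finset.sum_const, Finset.card_univ, nsmul_eq_mul]
          ring
  calc _ ≤ ∑ s : Fin n → Bool, ∑ z, (2 ^ n : ℝ)⁻¹ *
        (p z * ‖average D z + signedAverage D s z - condOp K s z b b'‖ +
        (Fintype.card X + 2) * (p z * choiDefect (condOp K s z))) :=
        (norm_sum_le _ _).trans (Finset.sum_le_sum fun s _ =>
          (norm_sum_le _ _).trans (Finset.sum_le_sum fun z _ => hterm s z))
    _ = (2 ^ n : ℝ)⁻¹ * ((∑ s : Fin n → Bool, ∑ z,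
          p z * ‖average D z + signedAverage D s z - condOp K s z b b'‖) +
        (Fintype.card X + 2) * ∑ s : Fin n → Bool, ∑ z, p z * choiDefect (condOp K s z)) := by
        simp only [Finset.mul_sum, Finset.sum_add_distrib, mul_add]
    _ ≤ (2 ^ n : ℝ)⁻¹ * (2 ^ n * (4 * c * Fintype.card A / √n) +
        (Fintype.card X + 2) * (2 ^ n * ((Fintype.card X ^ 2 *
          (2 * (Fintype.card Y * c) + 1)) * Fintype.card A / √n))) := by
        gcongr
    _ = _ := by
        rw [approxConst, ← hc]
        field_simp

end DeFinetti

/-! ### Choi operators and finite measure-and-prepare channels -/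

section Channels

open Matrix
open scoped Kronecker

variable {ι κ A X Y G : Type*} [Fintype ι] [Fintype κ] [DecidableEq ι] [Fintype A] [Fintype X]
  [Fintype Y] [DecidableEq A] [DecidableEq X] [DecidableEq Y] {n : ℕ}

/-- The (unnormalized) Choi operator. -/
def choi (Φ : SuperOp ι κ) : Op (ι × κ) :=
  Matrix.of fun p q => Φ (single p.1 q.1 1) p.2 q.2

lemma apply_eq_sum_choi (Φ : SuperOp ι κ) (ρ : Op ι) (y y' : κ) :
    Φ ρ y y' = ∑ x, ∑ x', ρ x x' * choi Φ (x, y) (x', y') := by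
  conv_lhs => rw [matrix_eq_sum_single ρ]
  simp only [map_sum, Matrix.sum_apply]
  refine Finset.sum_congr rfl fun x _ => Finset.sum_congr rfl fun x' _ => ?_
  have : single x x' (ρ x x') = ρ x x' • single x x' (1 : ℂ) := by
    rw [smul_single, smul_eq_mul, mul_one]
  rw [this, map_smul, Matrix.smul_apply, smul_eq_mul]
  rfl

/-- The Choi operator is the image of the unnormalized maximally entangled projector, with the
ancilla relabelled by `Fin (Fintype.card ι)`. -/
lemma IsChannel.choi_posSemidef {Φ : SuperOp ι κ} (h : IsChannel Φ) : (choi Φ).PosSemidef := by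
  let e := Fintype.equivFin ι
  let v : ι × Fin (Fintype.card ι) → ℂ := fun p => if e p.1 = p.2 then 1 else 0
  have := h.completelyPositive _ _ (posSemidef_vecMulVec_self_star v)
  convert this.submatrix (fun p : ι × κ => (p.2, e p.1)) using 1
  ext p q
  simp only [choi, tensorId, of_apply, submatrix_apply]
  have hv : (Matrix.of fun x u => vecMulVec v (star v) (x, e p.1) (u, e q.1))
      = single p.1 q.1 (1 : ℂ) := by
    ext x x'
    simp only [single_apply, eq_comm (a := p.1), eq_comm (a := q.1)]
    by_cases h1 : x = p.1 <;> by_cases h2 : x' = q.1 <;> simp [vecMulVec_apply, v, h1, h2]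
  rw [hv]

lemma IsChannel.traceRight_choi {Φ : SuperOp ι κ} (h : IsChannel Φ) :
    traceRight (choi Φ) = 1 := by
  ext x x'
  have := h.trace_preserving (single x x' 1)
  simp only [traceRight, choi, of_apply]
  rw [one_apply]
  refine this.trans ?_
  split_ifs with hx
  · simp [hx]
  · exact trace_single_eq_of_ne _ _ _ hx

/-- A rank-one decomposition of the Choi operator yields Kraus operators, hence complete positivity
with any ancilla. -/
lemma isChannel_of_choi {Φ : SuperOp ι κ} (hpos : (choi Φ).PosSemidef)
    (htr : traceRight (choi Φ) = 1) : IsChannel Φ where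
  completelyPositive k M hM := by
    obtain ⟨m, v, hv⟩ := Matrix.posSemidef_iff_eq_sum_vecMulVec.mp hpos
    have e : tensorId Φ M = ∑ j, (Matrix.of fun (x : ι × Fin k) (y : κ × Fin k) =>
        if x.2 = y.2 then star (v j (x.1, y.1)) else 0)ᴴ * M *
        (Matrix.of fun (x : ι × Fin k) (y : κ × Fin k) =>
        if x.2 = y.2 then star (v j (x.1, y.1)) else 0) := by
      ext ⟨y, r⟩ ⟨y', r'⟩
      rw [Matrix.sum_apply]
      simp only [tensorId, of_apply, apply_eq_sum_choi, hv, Matrix.sum_apply, vecMulVec_apply,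
        mul_apply, conjTranspose_apply, Fintype.sum_prod_type, Finset.mul_sum, Finset.sum_mul,
        apply_ite star, star_star, star_zero, ite_mul, mul_ite, zero_mul, mul_zero,
        Finset.sum_ite_eq', Finset.mem_univ, if_true]
      rw [Finset.sum_comm]
      conv_rhs => rw [Finset.sum_comm]
      refine Finset.sum_congr rfl fun x' _ => ?_
      rw [Finset.sum_comm]
      refine Finset.sum_congr rfl fun j _ => Finset.sum_congr rfl fun x _ => ?_
      rw [Pi.star_apply]
      ring
    rw [e]
    exact posSemidef_sum _ fun j _ => hM.conjTranspose_mul_mul_same _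
  trace_preserving M := by
    have e : (Φ M).trace = ∑ x, ∑ x', M x x' * traceRight (choi Φ) x x' := by
      simp only [Matrix.trace, diag_apply, apply_eq_sum_choi, traceRight, of_apply, Finset.mul_sum]
      rw [Finset.sum_comm]
      refine Finset.sum_congr rfl fun x _ => ?_
      rw [Finset.sum_comm]
    rw [e, htr]
    simp [one_apply, Matrix.trace]

/-- The map with a given Choi operator. -/
def ofChoi (C : Op (X × Y)) : SuperOp X Y where
  toFun ρ := Matrix.of fun y y' => ∑ x, ∑ x', ρ x x' * C (x, y) (x', y')
  map_add' ρ σ := by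
    ext y y'
    simp [add_mul, Finset.sum_add_distrib]
  map_smul' c ρ := by
    ext y y'
    simp [Finset.mul_sum, mul_assoc]

lemma choi_ofChoi (C : Op (X × Y)) : choi (ofChoi C) = C := by
  ext ⟨x, y⟩ ⟨x', y'⟩
  simp [choi, ofChoi, single_apply, ite_and]

lemma posSemidef_tensorPower {B : Type*} [Fintype B] {C : Op B} (hC : C.PosSemidef) :
    (Matrix.of fun β β' : Fin n → B => ∏ i, C (β i) (β' i)).PosSemidef := by
  obtain ⟨m, v, rfl⟩ := Matrix.posSemidef_iff_eq_sum_vecMulVec.mp hC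
  refine Matrix.posSemidef_iff_eq_sum_vecMulVec.mpr
    ⟨Fintype.card (Fin n → Fin m), fun r β => ∏ i, v ((Fintype.equivFin _).symm r i) (β i), ?_⟩
  ext β β'
  simp only [of_apply, Matrix.sum_apply, vecMulVec_apply, Pi.star_apply]
  rw [Fintype.prod_sum]
  rw [← Equiv.sum_comp (Fintype.equivFin (Fin n → Fin m)).symm]
  refine Finset.sum_congr rfl fun r _ => ?_
  rw [Finset.prod_mul_distrib, star_prod]

variable [Fintype G] [MeasurableSpace G] [MeasurableSingletonClass G]

/-- The POVM on a finite set given by a family of effects. -/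
def finitePOVM (E : G → Op A) (hE : ∀ g, (E g).PosSemidef) (hsum : ∑ g, E g = 1) : POVM G A where
  measure := ∑ g, VectorMeasure.dirac g (E g)
  posSemidef s hs := by
    classical
    rw [_root_.sum_apply]
    refine posSemidef_sum _ fun g _ => ?_
    by_cases hg : g ∈ s
    · rw [VectorMeasure.dirac_apply_of_mem hs hg]; exact hE g
    · rw [VectorMeasure.dirac_apply_of_notMem hg]; exact PosSemidef.zero
  total := by
    rw [_root_.sum_apply, ← hsum]
    exact Finset.sum_congr rfl fun g _ =>
      VectorMeasure.dirac_apply_of_mem MeasurableSet.univ (Set.mem_univ g)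

lemma integrable_dirac_vectorMeasure (g : G) (c : ℂ) (f : G → ℂ) :
    (VectorMeasure.dirac g c).Integrable f := by
  have h : (VectorMeasure.dirac g c).variation = ‖c‖ₑ • Measure.dirac g :=
    VectorMeasure.variation_dirac
  rw [VectorMeasure.Integrable, h]
  exact (integrable_dirac (by finiteness)).smul_measure (by finiteness)

lemma integral_entry_finitePOVM (E : G → Op A) (hE : ∀ g, (E g).PosSemidef)
    (hsum : ∑ g, E g = 1) (a b : A) (f : G → ℂ) :
    ((finitePOVM E hE hsum).entry a b).integral f (ContinuousLinearMap.mul ℝ ℂ)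
      = ∑ g, f g * E g a b := by
  have e : (finitePOVM E hE hsum).entry a b = ∑ g, VectorMeasure.dirac g (E g a b) := by
    classical
    ext s hs
    rw [_root_.sum_apply]
    simp only [POVM.entry, VectorMeasure.mapRange_apply, finitePOVM, _root_.sum_apply, map_sum]
    refine Finset.sum_congr rfl fun g _ => ?_
    by_cases hg : g ∈ s
    · rw [VectorMeasure.dirac_apply_of_mem hs hg, VectorMeasure.dirac_apply_of_mem hs hg]
      rfl
    · rw [VectorMeasure.dirac_apply_of_notMem hg, VectorMeasure.dirac_apply_of_notMem hg, map_zero]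
  rw [e, VectorMeasure.integral_finsetSum_vectorMeasure
    fun g _ => integrable_dirac_vectorMeasure g _ f]
  simp_rw [VectorMeasure.integral_dirac]
  rfl

/-- The effect appears transposed because `tr[E |a⟩⟨a'|]` is the entry `(a', a)` of `E`. -/
lemma choi_measurePrepare (E : G → Op A) (hE : ∀ g, (E g).PosSemidef) (hsum : ∑ g, E g = 1)
    (C : G → Op (X × Y)) (a a' : A) (x x' : Fin n → X) (y y' : Fin n → Y) :
    choi (measurePrepare (finitePOVM E hE hsum) (fun g => ofChoi (C g)) n)
      ((a, x), y) ((a', x'), y') = ∑ g, E g a' a * ∏ i, C g (x i, y i) (x' i, y' i) := by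
  have h1 : ∀ g, tensorPower (ofChoi (C g)) n (single x x' 1) y y'
      = ∏ i, C g (x i, y i) (x' i, y' i) := by
    intro g
    have : ∀ i, ofChoi (C g) (single (x i) (x' i) 1) (y i) (y' i)
        = C g (x i, y i) (x' i, y' i) := fun i => by
      conv_rhs => rw [← choi_ofChoi (C g)]
      rfl
    simp only [← this]
    simp [tensorPower, single_apply, ite_and]
  simp only [choi, of_apply, measurePrepare, LinearMap.coe_mk, AddHom.coe_mk]
  rw [Finset.sum_eq_single (a, x), Finset.sum_eq_single (a', x')]
  · rw [single_apply_same, one_mul, integral_entry_finitePOVM]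
    simp_rw [h1, mul_comm]
  · intro q _ hq
    rw [single_apply, if_neg (fun h => hq h.2.symm), zero_mul]
  · simp
  · intro p _ hp
    refine Finset.sum_eq_zero fun q _ => ?_
    rw [single_apply, if_neg (fun h => hp h.1.symm), zero_mul]
  · simp

lemma isChannel_measurePrepare (E : G → Op A) (hE : ∀ g, (E g).PosSemidef)
    (hsum : ∑ g, E g = 1) (C : G → Op (X × Y)) (hC : ∀ g, (C g).PosSemidef)
    (htr : ∀ g, traceRight (C g) = 1) :
    IsChannel (measurePrepare (finitePOVM E hE hsum) (fun g => ofChoi (C g)) n) := by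
  refine isChannel_of_choi ?_ ?_
  · have : choi (measurePrepare (finitePOVM E hE hsum) (fun g => ofChoi (C g)) n)
        = ∑ g, ((E g)ᵀ ⊗ₖ (Matrix.of fun β β' : Fin n → X × Y =>
          ∏ i, C g (β i) (β' i))).submatrix
          (fun p : (A × (Fin n → X)) × (Fin n → Y) => (p.1.1, fun i => (p.1.2 i, p.2 i)))
          (fun p : (A × (Fin n → X)) × (Fin n → Y) => (p.1.1, fun i => (p.1.2 i, p.2 i))) := by
      ext ⟨⟨a, x⟩, y⟩ ⟨⟨a', x'⟩, y'⟩
      rw [choi_measurePrepare, Matrix.sum_apply]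
      rfl
    rw [this]
    exact posSemidef_sum _ fun g _ =>
      ((hE g).transpose.kronecker (posSemidef_tensorPower (hC g))).submatrix _
  · ext ⟨a, x⟩ ⟨a', x'⟩
    simp only [traceRight, of_apply, choi_measurePrepare]
    rw [Finset.sum_comm]
    simp_rw [← Finset.mul_sum]
    have h2 : ∀ g, ∑ y : Fin n → Y, ∏ i, C g (x i, y i) (x' i, y i)
        = ∏ i, (1 : Op X) (x i) (x' i) := by
      intro g
      rw [← Fintype.prod_sum (f := fun i w => C g (x i, w) (x' i, w))]
      exact Finset.prod_congr rfl fun i _ => by rw [← htr g]; rfl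
    simp_rw [h2, ← Finset.sum_mul]
    have h3 : ∑ g, E g a' a = (1 : Op A) a' a := by rw [← hsum, Matrix.sum_apply]
    rw [h3]
    have h6 : (∀ i ∈ Finset.univ, x i = x' i) ↔ x = x' := by simp [funext_iff]
    simp only [one_apply, Prod.mk.injEq, Finset.prod_ite_zero, Finset.prod_const_one, h6,
      @eq_comm _ a' a]
    by_cases h4 : a = a' <;> by_cases h5 : x = x' <;> simp [h4, h5]

end Channels

/-! ### The risk in terms of the Choi kernel -/

section Kernel

open Matrix
open scoped Kronecker

variable {A X Y Z G : Type*} [Fintype A] [Fintype X] [Fintype Y] [Fintype Z] [DecidableEq A]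
  [DecidableEq X] [DecidableEq Y] [DecidableEq Z] {n : ℕ}

lemma sum_sum_comm {ι₁ ι₂ ι₃ ι₄ : Type*} [Fintype ι₁] [Fintype ι₂] [Fintype ι₃] [Fintype ι₄]
    (F : ι₁ → ι₂ → ι₃ → ι₄ → ℂ) :
    ∑ a, ∑ b, ∑ c, ∑ d, F a b c d = ∑ c, ∑ d, ∑ a, ∑ b, F a b c d := by
  have h := Finset.sum_comm (s := (Finset.univ : Finset (ι₁ × ι₂)))
    (t := (Finset.univ : Finset (ι₃ × ι₄))) (f := fun p q => F p.1 p.2 q.1 q.2)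
  simpa only [Fintype.sum_prod_type] using h

/-- The Choi operator of a map from `A ⊗ X^{⊗n}` to `Y^{⊗n}`, with the registers regrouped as
`A ⊗ (X ⊗ Y)^{⊗n}`. -/
def kernel (P : SuperOp (A × (Fin n → X)) (Fin n → Y)) : Op (A × (Fin n → X × Y)) :=
  (choi P).submatrix (fun p => ((p.1, fun i => (p.2 i).1), fun i => (p.2 i).2))
    (fun p => ((p.1, fun i => (p.2 i).1), fun i => (p.2 i).2))

lemma pairing_kernel (P : SuperOp (A × (Fin n → X)) (Fin n → Y)) (R : Op A)
    (N : Fin n → Op (X × Y)) :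
    pairing (kernel P) R N = ∑ y : Fin n → Y, ∑ y' : Fin n → Y,
      ∑ p : A × (Fin n → X), ∑ q : A × (Fin n → X),
      R p.1 q.1 * (∏ i, N i (p.2 i, y i) (q.2 i, y' i)) * choi P (p, y) (q, y') := by
  let e : (Fin n → Y) × (A × (Fin n → X)) ≃ A × (Fin n → X × Y) :=
    { toFun t := (t.2.1, fun i => (t.2.2 i, t.1 i))
      invFun α := (fun i => (α.2 i).2, (α.1, fun i => (α.2 i).1))
      left_inv _ := rfl
      right_inv _ := rfl }
  calc pairing (kernel P) R N = ∑ α : A × (Fin n → X × Y), ∑ α' : A × (Fin n → X × Y),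
        R α.1 α'.1 * kernel P α α' * ∏ i, N i (α.2 i) (α'.2 i) := by
        rw [pairing_apply, Fintype.sum_prod_type]
        refine Finset.sum_congr rfl fun a _ => ?_
        rw [Finset.sum_comm]
        refine Finset.sum_congr rfl fun β _ => ?_
        rw [Fintype.sum_prod_type]
    _ = ∑ t : (Fin n → Y) × (A × (Fin n → X)), ∑ t' : (Fin n → Y) × (A × (Fin n → X)),
        R t.2.1 t'.2.1 * choi P (t.2, t.1) (t'.2, t'.1) *
          ∏ i, N i (t.2.2 i, t.1 i) (t'.2.2 i, t'.1 i) := by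
        rw [← e.sum_comp]
        refine Finset.sum_congr rfl fun t _ => ?_
        rw [← e.sum_comp]
        rfl
    _ = _ := by
        rw [Fintype.sum_prod_type]
        refine Finset.sum_congr rfl fun y _ => ?_
        simp_rw [Fintype.sum_prod_type (α₁ := Fin n → Y)]
        rw [Finset.sum_comm]
        refine Finset.sum_congr rfl fun y' _ => Finset.sum_congr rfl fun p _ =>
          Finset.sum_congr rfl fun q _ => ?_
        ring

/-- Identities on all outputs trace them out, which turns the Choi operator into the identity on the
inputs. -/
lemma IsChannel.isTracePreservingKernel {P : SuperOp (A × (Fin n → X)) (Fin n → Y)}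
    (hP : IsChannel P) : IsTracePreservingKernel (kernel P) := by
  intro R N
  rw [pairing_kernel]
  have hprod : ∀ (p q : A × (Fin n → X)) (y y' : Fin n → Y),
      ∏ i, (N i ⊗ₖ (1 : Op Y)) (p.2 i, y i) (q.2 i, y' i)
        = if y = y' then ∏ i, N i (p.2 i) (q.2 i) else 0 := by
    intro p q y y'
    simp only [kroneckerMap_apply, one_apply, mul_ite, mul_one, mul_zero, Finset.prod_ite_zero]
    simp [funext_iff]
  have hTP : ∀ p q : A × (Fin n → X), ∑ y, choi P (p, y) (q, y) = if p = q then 1 else 0 := by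
    intro p q
    have := congrFun (congrFun hP.traceRight_choi p) q
    rwa [one_apply] at this
  simp only [hprod, mul_ite, ite_mul, mul_zero, zero_mul]
  calc _ = ∑ y : Fin n → Y, ∑ p : A × (Fin n → X), ∑ q : A × (Fin n → X),
        R p.1 q.1 * (∏ i, N i (p.2 i) (q.2 i)) * choi P (p, y) (q, y) := by
        refine Finset.sum_congr rfl fun y _ => ?_
        rw [Finset.sum_eq_single y]
        · simp
        · intro y' _ h
          simp [h.symm]
        · simp
    _ = ∑ p : A × (Fin n → X), ∑ q : A × (Fin n → X),
        R p.1 q.1 * (∏ i, N i (p.2 i) (q.2 i)) * if p = q then 1 else 0 := by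
        rw [Finset.sum_comm]
        refine Finset.sum_congr rfl fun p _ => ?_
        rw [Finset.sum_comm]
        refine Finset.sum_congr rfl fun q _ => ?_
        rw [← Finset.mul_sum, hTP]
    _ = ∑ p : A × (Fin n → X), R p.1 p.1 * ∏ i, N i (p.2 i) (p.2 i) := by simp
    _ = _ := by
        rw [Fintype.sum_prod_type]
        simp only [← Finset.mul_sum, Matrix.trace, diag_apply, Finset.sum_mul]
        rw [Fintype.prod_sum]

/-- The pairing of `S` with the marginal state of the registers `X ⊗ Z`. -/
def riskWeight (ρ : Op (X × Z)) (S : Op (Y × Z)) : Op (X × Y) :=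
  Matrix.of fun b b' => ∑ ζ, ∑ ζ', ρ (b.1, ζ) (b'.1, ζ') * S (b'.2, ζ') (b.2, ζ)

/-- Away from register `i` the observable is the identity, so `Z` is traced out there and only the
reduced input state remains. -/
lemma expectedRisk_eq (P : SuperOp (A × (Fin n → X)) (Fin n → Y)) (S : Op (Y × Z)) (ρA : Op A)
    (ρ : Op (X × Z)) :
    expectedRisk P S ρA ρ = (n : ℂ)⁻¹ * ∑ i, pairing (kernel P) ρA
      (Function.update (fun _ => traceRight ρ ⊗ₖ (1 : Op Y)) i (riskWeight ρ S)) := by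
  rw [expectedRisk, symmetrized, Matrix.mul_smul, trace_smul, smul_eq_mul, Matrix.mul_sum,
    trace_sum]
  congr 1
  refine Finset.sum_congr rfl fun i _ => ?_
  rw [pairing_kernel]
  have hslot : ∀ (p q : A × (Fin n → X)) (y y' : Fin n → Y),
      ∏ j, (Function.update (fun _ => traceRight ρ ⊗ₖ (1 : Op Y)) i (riskWeight ρ S) : Fin n → _)
        j (p.2 j, y j) (q.2 j, y' j)
      = ∑ z : Fin n → Z, ∑ z' : Fin n → Z, (∏ j, ρ (p.2 j, z j) (q.2 j, z' j)) *
          localAt i S (y', z') (y, z) := by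
    intro p q y y'
    have h1 : ∀ z z' : Fin n → Z, localAt i S (y', z') (y, z)
        = ∏ j, if j = i then S (y' j, z' j) (y j, z j) else
            if y' j = y j ∧ z' j = z j then 1 else 0 := by
      intro z z'
      rw [localAt, of_apply, ← Finset.mul_prod_erase Finset.univ _ (Finset.mem_univ i), if_pos rfl]
      congr 1
      have : ∀ j ∈ Finset.univ.erase i, (if j = i then S (y' j, z' j) (y j, z j) else
            if y' j = y j ∧ z' j = z j then 1 else 0) =
            if y' j = y j ∧ z' j = z j then (1 : ℂ) else 0 := by
        intro j hj
        rw [if_neg (Finset.ne_of_mem_erase hj)]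
      rw [Finset.prod_congr rfl this, Finset.prod_ite_zero, Finset.prod_const_one]
      simp
    simp_rw [h1, ← Finset.prod_mul_distrib]
    have h2 : ∀ j, (Function.update (fun _ => traceRight ρ ⊗ₖ (1 : Op Y)) i (riskWeight ρ S) :
        Fin n → _) j (p.2 j, y j) (q.2 j, y' j) = ∑ ζ, ∑ ζ', ρ (p.2 j, ζ) (q.2 j, ζ') *
          if j = i then S (y' j, ζ') (y j, ζ) else if y' j = y j ∧ ζ' = ζ then 1 else 0 := by
      intro j
      by_cases hj : j = i
      · subst hj
        simp [riskWeight]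
      · rw [Function.update_of_ne hj]
        by_cases hy : y' j = y j
        · simp [hj, hy, traceRight]
        · simp [hj, hy, Ne.symm hy, one_apply]
    simp_rw [h2]
    rw [Fintype.prod_sum]
    refine Finset.sum_congr rfl fun z _ => ?_
    rw [Fintype.prod_sum]
  simp_rw [hslot]
  rw [Matrix.trace]
  simp only [diag_apply, mul_apply, Fintype.sum_prod_type (α₁ := Fin n → Y)]
  have hT : ∀ (y y' : Fin n → Y) (z z' : Fin n → Z),
      tensorId P (inputState n ρA ρ) (y, z) (y', z') = ∑ p, ∑ q,
        ρA p.1 q.1 * (∏ j, ρ (p.2 j, z j) (q.2 j, z' j)) * choi P (p, y) (q, y') := by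
    intro y y' z z'
    simp only [tensorId, of_apply, apply_eq_sum_choi, inputState]
  simp_rw [hT]
  refine Finset.sum_congr rfl fun y _ => ?_
  rw [Finset.sum_comm]
  refine Finset.sum_congr rfl fun y' _ => ?_
  simp only [Finset.sum_mul, Finset.mul_sum]
  rw [sum_sum_comm]
  refine Finset.sum_congr rfl fun p _ => Finset.sum_congr rfl fun q _ =>
    Finset.sum_congr rfl fun z _ => Finset.sum_congr rfl fun z' _ => ?_
  ring

end Kernel

/-! ### Consequences of non-signalling -/

section NonSignalling

open Matrix
open scoped Kronecker

variable {A X Y : Type*} [Fintype A] [Fintype X] [Fintype Y] [DecidableEq A]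
  [DecidableEq X] [DecidableEq Y] {n : ℕ}

lemma sum_eq_sum_funSplitAt (i : Fin n) (F : (Fin n → Y) → ℂ) :
    ∑ η, F η = ∑ y, ∑ k, F ((Equiv.funSplitAt i Y).symm (y, k)) := by
  rw [← (Equiv.funSplitAt i Y).symm.sum_comp, Fintype.sum_prod_type]

lemma prod_funSplitAt (i : Fin n) (f : Fin n → Op X) (x x' : X)
    (k k' : {j : Fin n // j ≠ i} → X) :
    ∏ j, f j ((Equiv.funSplitAt i X).symm (x, k) j) ((Equiv.funSplitAt i X).symm (x', k') j)
      = f i x x' * ∏ j : {j : Fin n // j ≠ i}, f j (k j) (k' j) := by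
  rw [Fintype.prod_eq_mul_prod_subtype_ne _ i]
  congr 1
  · simp
  · refine Finset.prod_congr rfl fun j _ => ?_
    simp [j.2]

/-- The operator `R ⊗ W ⊗ τ ⊗ ⋯ ⊗ τ` with `W` on the `i`-th register. -/
def productOp (i : Fin n) (R : Op A) (W τ : Op X) : Op (A × (Fin n → X)) :=
  Matrix.of fun p q => R p.1 q.1 * ∏ j, (Function.update (fun _ => τ) i W : Fin n → Op X) j
    (p.2 j) (q.2 j)

lemma inMarginal_productOp (i : Fin n) (R : Op A) (W τ : Op X) (hτ : τ.trace = 1) :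
    inMarginal i (productOp i R W τ) = R ⊗ₖ W := by
  ext ⟨a, x⟩ ⟨a', x'⟩
  simp only [inMarginal, traceRight, of_apply, submatrix_apply, productOp, prod_funSplitAt,
    Function.update_self, kroneckerMap_apply, ← Finset.mul_sum]
  have : ∑ k : {j : Fin n // j ≠ i} → X, ∏ j : {j : Fin n // j ≠ i},
      (Function.update (fun _ => τ) i W : Fin n → Op X) j (k j) (k j) = 1 := by
    rw [← Fintype.prod_sum (f := fun (j : {j : Fin n // j ≠ i}) w =>
      (Function.update (fun _ => τ) i W : Fin n → Op X) j w w)]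
    refine Finset.prod_eq_one fun j _ => ?_
    rw [Function.update_of_ne j.2]
    exact hτ
  rw [this, mul_one]

lemma pairing_kernel_eq_outMarginal (P : SuperOp (A × (Fin n → X)) (Fin n → Y)) (i : Fin n)
    (R : Op A) (W τ : Op X) (y y' : Y) :
    pairing (kernel P) R
      (Function.update (fun _ => τ ⊗ₖ (1 : Op Y)) i (W ⊗ₖ single y y' (1 : ℂ)))
      = outMarginal i (P (productOp i R W τ)) y y' := by
  have hprod : ∀ (p q : A × (Fin n → X)) (η η' : Fin n → Y),
      ∏ j, (Function.update (fun _ => τ ⊗ₖ (1 : Op Y)) i (W ⊗ₖ single y y' (1 : ℂ)) : Fin n → _)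
        j (p.2 j, η j) (q.2 j, η' j)
      = (∏ j, (Function.update (fun _ => τ) i W : Fin n → Op X) j (p.2 j) (q.2 j)) *
        ∏ j, (Function.update (fun _ => 1) i (single y y' (1 : ℂ)) : Fin n → Op Y)
          j (η j) (η' j) := by
    intro p q η η'
    rw [← Finset.prod_mul_distrib]
    refine Finset.prod_congr rfl fun j _ => ?_
    by_cases hj : j = i
    · subst hj; simp
    · simp [hj]
  rw [pairing_kernel]
  calc _ = ∑ η, ∑ η', (∏ j, (Function.update (fun _ => 1) i (single y y' (1 : ℂ)) : Fin n → Op Y)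
          j (η j) (η' j)) * P (productOp i R W τ) η η' := by
        refine Finset.sum_congr rfl fun η _ => Finset.sum_congr rfl fun η' _ => ?_
        rw [apply_eq_sum_choi, Finset.mul_sum]
        refine Finset.sum_congr rfl fun p _ => ?_
        rw [Finset.mul_sum]
        refine Finset.sum_congr rfl fun q _ => ?_
        rw [hprod, productOp, of_apply]
        ring
    _ = _ := by
        rw [sum_eq_sum_funSplitAt i]
        simp_rw [sum_eq_sum_funSplitAt i (fun η' => _ * P (productOp i R W τ) _ η'),
          prod_funSplitAt, Function.update_self]
        have h1 : ∀ k k' : {j : Fin n // j ≠ i} → Y, ∏ j : {j : Fin n // j ≠ i},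
            (Function.update (fun _ => 1) i (single y y' (1 : ℂ)) : Fin n → Op Y) j (k j) (k' j)
            = if k = k' then 1 else 0 := by
          intro k k'
          have : ∀ j : {j : Fin n // j ≠ i},
              (Function.update (fun _ => 1) i (single y y' (1 : ℂ)) : Fin n → Op Y) j
              (k j) (k' j) = if k j = k' j then 1 else 0 := by
            intro j
            rw [Function.update_of_ne j.2, one_apply]
          simp_rw [this, Finset.prod_ite_zero, Finset.prod_const_one]
          simp [funext_iff]
        simp_rw [h1]
        rw [Finset.sum_eq_single y]
        · simp only [outMarginal, traceRight, of_apply, submatrix_apply]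
          refine Finset.sum_congr rfl fun k _ => ?_
          rw [Finset.sum_eq_single y', Finset.sum_eq_single k]
          · simp
          · intro k' _ h
            simp [h.symm]
          · simp
          · intro u _ h
            simp [h.symm]
          · simp
        · intro u _ h
          simp [h.symm]
        · simp

lemma inMarginal_add (i : Fin n) (M N : Op (A × (Fin n → X))) :
    inMarginal i (M + N) = inMarginal i M + inMarginal i N := by
  ext p q
  simp [inMarginal, traceRight, Finset.sum_add_distrib]

lemma inMarginal_smul (i : Fin n) (c : ℂ) (M : Op (A × (Fin n → X))) :
    inMarginal i (c • M) = c • inMarginal i M := by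
  ext p q
  simp [inMarginal, traceRight, Finset.mul_sum]

lemma inMarginal_conjTranspose (i : Fin n) (M : Op (A × (Fin n → X))) :
    inMarginal i Mᴴ = (inMarginal i M)ᴴ := by
  ext p q
  simp [inMarginal, traceRight]

lemma trace_inMarginal (i : Fin n) (M : Op (A × (Fin n → X))) :
    (inMarginal i M).trace = M.trace := by
  simp only [Matrix.trace, diag_apply, Fintype.sum_prod_type]
  refine Finset.sum_congr rfl fun a _ => ?_
  rw [sum_eq_sum_funSplitAt i]
  rfl

lemma outMarginal_add (i : Fin n) (M N : Op (Fin n → Y)) :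
    outMarginal i (M + N) = outMarginal i M + outMarginal i N := by
  ext p q
  simp [outMarginal, traceRight, Finset.sum_add_distrib]

lemma outMarginal_smul (i : Fin n) (c : ℂ) (M : Op (Fin n → Y)) :
    outMarginal i (c • M) = c • outMarginal i M := by
  ext p q
  simp [outMarginal, traceRight, Finset.mul_sum]

variable {Q : SuperOp (A × (Fin n → X)) (Fin n → Y)} [Nonempty A] [Nonempty X]

/-- Non-signalling speaks only of states. A Hermitian `D` with zero marginal is traceless, so a
small multiple of it can be added to the maximally mixed state, giving two states with the same
input marginal. The general case follows from Hermitian and anti-Hermitian parts. -/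
lemma NonSignalling.outMarginal_eq_zero_of_isHermitian (hQ : NonSignalling Q) (i : Fin n)
    {D : Op (A × (Fin n → X))} (hD : D.IsHermitian) (h0 : inMarginal i D = 0) :
    outMarginal i (Q D) = 0 := by
  set N : ℕ := Fintype.card (A × (Fin n → X)) with hN
  have hN0 : (0 : ℝ) < N := by exact_mod_cast Fintype.card_pos
  set c : ℝ := 1 + ∑ x, ∑ x', ‖D x x'‖ with hc
  have hc0 : 0 < c := by positivity
  have hNC : (N : ℂ) ≠ 0 := by exact_mod_cast hN0.ne'
  have hcC : (c : ℂ) ≠ 0 := by exact_mod_cast hc0.ne'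
  have htr : D.trace = 0 := by rw [← trace_inMarginal i, h0, trace_zero]
  have h1 : IsState ((((N : ℝ)⁻¹ : ℝ) : ℂ) • (1 : Op (A × (Fin n → X)))) := by
    refine ⟨PosSemidef.one.smul (by rw [Complex.zero_le_real]; positivity), ?_⟩
    rw [trace_smul, trace_one, smul_eq_mul, ← hN]
    push_cast
    exact inv_mul_cancel₀ hNC
  have h2 : IsState ((((c * N)⁻¹ : ℝ) : ℂ) • ((c : ℂ) • (1 : Op (A × (Fin n → X))) - -D)) := by
    refine ⟨(posSemidef_smul_one_sub hD.neg ?_).smul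
      (by rw [Complex.zero_le_real]; positivity), ?_⟩
    · simp [hc]
    · rw [trace_smul, trace_sub, trace_neg, htr, trace_smul, trace_one, ← hN]
      push_cast
      simp only [smul_eq_mul, neg_zero, sub_zero]
      exact inv_mul_cancel₀ (mul_ne_zero hcC hNC)
  have e : (((c * N)⁻¹ : ℝ) : ℂ) • ((c : ℂ) • (1 : Op (A × (Fin n → X))) - -D)
      = (((N : ℝ)⁻¹ : ℝ) : ℂ) • (1 : Op (A × (Fin n → X))) + (((c * N)⁻¹ : ℝ) : ℂ) • D := by
    rw [sub_neg_eq_add, smul_add, smul_smul]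
    congr 2
    push_cast
    field_simp
  have key := hQ i _ _ h2 h1 (by rw [e, inMarginal_add, inMarginal_smul i _ D, h0]; simp)
  rw [e, map_add, outMarginal_add, add_eq_left, map_smul, outMarginal_smul, smul_eq_zero] at key
  refine key.resolve_left ?_
  rw [Complex.ofReal_eq_zero]
  positivity

lemma NonSignalling.outMarginal_eq_zero (hQ : NonSignalling Q) (i : Fin n)
    {D : Op (A × (Fin n → X))} (h0 : inMarginal i D = 0) : outMarginal i (Q D) = 0 := by
  have h1 := hQ.outMarginal_eq_zero_of_isHermitian i (D := D + Dᴴ)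
    (isHermitian_add_transpose_self D)
    (by rw [inMarginal_add, inMarginal_conjTranspose, h0]; simp)
  have h2 := hQ.outMarginal_eq_zero_of_isHermitian i
    (D := Complex.I • D + (Complex.I • D)ᴴ) (isHermitian_add_transpose_self _)
    (by rw [inMarginal_add, inMarginal_conjTranspose, inMarginal_smul, h0]; simp)
  have e : D = (2⁻¹ : ℂ) • (D + Dᴴ) +
      (-(2⁻¹ * Complex.I)) • (Complex.I • D + (Complex.I • D)ᴴ) := by
    ext p q
    simp only [Matrix.add_apply, Matrix.smul_apply, conjTranspose_apply, smul_eq_mul, star_mul',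
      Complex.star_def, Complex.conj_I]
    linear_combination (2⁻¹ * D p q - 2⁻¹ * (starRingEnd ℂ) (D q p)) * Complex.I_mul_I
  rw [e, map_add, map_smul, map_smul, outMarginal_add, outMarginal_smul, outMarginal_smul, h1, h2]
  simp

lemma NonSignalling.outMarginal_eq (hQ : NonSignalling Q) (i : Fin n)
    {ρ σ : Op (A × (Fin n → X))} (h : inMarginal i ρ = inMarginal i σ) :
    outMarginal i (Q ρ) = outMarginal i (Q σ) := by
  have e : ρ = σ + (ρ + (-1 : ℂ) • σ) := by
    rw [neg_smul, one_smul]; abel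
  rw [e, map_add, outMarginal_add, hQ.outMarginal_eq_zero i (D := _ + _), add_zero]
  rw [inMarginal_add, inMarginal_smul, h, neg_smul, one_smul, add_neg_cancel]

lemma NonSignalling.pairing_eq (hQ : NonSignalling Q) (i : Fin n) (R : Op A) (b b' : X × Y)
    {τ τ' : Op X} (hτ : τ.trace = 1) (hτ' : τ'.trace = 1) :
    pairing (kernel Q) R (Function.update (fun _ => τ ⊗ₖ (1 : Op Y)) i (single b b' 1))
      = pairing (kernel Q) R (Function.update (fun _ => τ' ⊗ₖ (1 : Op Y)) i (single b b' 1)) := by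
  have e : (single b b' 1 : Op (X × Y)) = single b.1 b'.1 1 ⊗ₖ single b.2 b'.2 (1 : ℂ) := by
    rw [single_kronecker_single, one_mul]
  rw [e, pairing_kernel_eq_outMarginal, pairing_kernel_eq_outMarginal,
    hQ.outMarginal_eq i ((inMarginal_productOp i R _ τ hτ).trans
      (inMarginal_productOp i R _ τ' hτ').symm)]

end NonSignalling

/-! ### Risk formulas and bounds by the operator norm -/

section Risk

open Matrix
open scoped Kronecker

variable {A X Y Z G : Type*} [Fintype A] [Fintype X] [Fintype Y] [Fintype Z] [DecidableEq A]
  [DecidableEq X] [DecidableEq Y] [DecidableEq Z] {n : ℕ}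

lemma norm_star_dotProduct_mulVec_le {ι : Type*} [Fintype ι] [DecidableEq ι] (S : Op ι)
    (u v : ι → ℂ) :
    ‖star u ⬝ᵥ (S *ᵥ v)‖ ≤ opNorm S * (‖WithLp.toLp 2 u‖ * ‖WithLp.toLp 2 v‖) := by
  have e : star u ⬝ᵥ (S *ᵥ v) = inner ℂ (WithLp.toLp 2 u)
      (Matrix.toEuclideanCLM (n := ι) (𝕜 := ℂ) S (WithLp.toLp 2 v)) := by
    rw [EuclideanSpace.inner_eq_star_dotProduct, Matrix.toEuclideanCLM_toLp, dotProduct_comm]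
  rw [e]
  refine (norm_inner_le_norm _ _).trans ?_
  calc _ ≤ ‖WithLp.toLp 2 u‖ * (opNorm S * ‖WithLp.toLp 2 v‖) := by
        gcongr
        exact ContinuousLinearMap.le_opNorm _ _
    _ = _ := by ring

/-- Each rank-one part of `ρ` contributes a matrix element of `S` between two vectors no longer than
the one defining that part. The squared lengths add up to the trace, so no dimension factor appears.
-/
lemma norm_riskWeight_le {ρ : Op (X × Z)} (hρ : IsState ρ) (S : Op (Y × Z)) (b b' : X × Y) :
    ‖riskWeight ρ S b b'‖ ≤ opNorm S := by
  obtain ⟨hpos, htr⟩ := hρ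
  obtain ⟨m, v, rfl⟩ := Matrix.posSemidef_iff_eq_sum_vecMulVec.mp hpos
  have hS : 0 ≤ opNorm S := norm_nonneg _
  let φ : Fin m → X × Y → Y × Z → ℂ := fun k b p => if p.1 = b.2 then v k (b.1, p.2) else 0
  have hφ : ∀ k b, ‖WithLp.toLp 2 (φ k b)‖ ^ 2 ≤ ∑ p, ‖v k p‖ ^ 2 := by
    intro k b
    rw [EuclideanSpace.norm_sq_eq, Fintype.sum_prod_type, Finset.sum_eq_single b.2,
      Fintype.sum_prod_type]
    · simp only [φ, if_true]
      exact Finset.single_le_sum (f := fun x => ∑ ζ, ‖v k (x, ζ)‖ ^ 2)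
        (fun x _ => by positivity) (Finset.mem_univ b.1)
    · intro y _ hy
      simp [φ, hy]
    · simp
  have htr' : ∑ k, ∑ p, ‖v k p‖ ^ 2 = 1 := by
    have : ((∑ k, ∑ p, ‖v k p‖ ^ 2 : ℝ) : ℂ) = 1 := by
      rw [← htr, trace_sum]
      push_cast
      refine Finset.sum_congr rfl fun k _ => Finset.sum_congr rfl fun p _ => ?_
      rw [diag_apply, vecMulVec_apply, Pi.star_apply, Complex.star_def, Complex.mul_conj,
        Complex.normSq_eq_norm_sq]
      push_cast; rfl
    exact_mod_cast this
  have e : riskWeight (∑ k, vecMulVec (v k) (star (v k))) S b b'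
      = ∑ k, star (φ k b') ⬝ᵥ (S *ᵥ φ k b) := by
    have hk : ∀ k, star (φ k b') ⬝ᵥ (S *ᵥ φ k b) = ∑ ζ, ∑ ζ',
        v k (b.1, ζ) * star (v k (b'.1, ζ')) * S (b'.2, ζ') (b.2, ζ) := by
      intro k
      rw [dotProduct, Fintype.sum_prod_type, Finset.sum_eq_single b'.2]
      · simp only [mulVec, dotProduct, Fintype.sum_prod_type, Pi.star_apply, φ, if_true, mul_ite,
          mul_zero]
        conv_rhs => rw [Finset.sum_comm]
        refine Finset.sum_congr rfl fun ζ' _ => ?_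
        rw [Finset.sum_eq_single b.2, Finset.mul_sum]
        · refine Finset.sum_congr rfl fun ζ _ => ?_
          rw [if_pos rfl]
          ring
        · intro y _ hy
          simp [hy]
        · simp
      · intro y _ hy
        simp [φ, hy]
      · simp
    simp_rw [hk]
    rw [Finset.sum_comm]
    simp only [riskWeight, of_apply, Matrix.sum_apply, vecMulVec_apply, Pi.star_apply,
      Finset.sum_mul]
    refine Finset.sum_congr rfl fun ζ _ => ?_
    rw [Finset.sum_comm]
  rw [e]
  calc _ ≤ ∑ k, opNorm S * ∑ p, ‖v k p‖ ^ 2 := by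
        refine (norm_sum_le _ _).trans (Finset.sum_le_sum fun k _ => ?_)
        refine (norm_star_dotProduct_mulVec_le S _ _).trans ?_
        refine mul_le_mul_of_nonneg_left ?_ hS
        nlinarith [hφ k b, hφ k b', sq_nonneg (‖WithLp.toLp 2 (φ k b)‖ -
          ‖WithLp.toLp 2 (φ k b')‖)]
    _ = _ := by rw [← Finset.mul_sum, htr', mul_one]

lemma trace_traceRight (ρ : Op (X × Z)) : (traceRight ρ).trace = ρ.trace := by
  simp [Matrix.trace, traceRight, Fintype.sum_prod_type]

lemma pairing_update_eq_sum {B : Type*} [Fintype B] [DecidableEq B] (K : Op (A × (Fin n → B)))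
    (R : Op A) (N : Fin n → Op B) (i : Fin n) (W : Op B) :
    pairing K R (Function.update N i W) = ∑ a, ∑ a', ∑ b, ∑ b', R a a' * W b b' *
      pairing K (single a a' 1) (Function.update N i (single b b' 1)) := by
  have hW : W = ∑ b, ∑ b', W b b' • single b b' (1 : ℂ) := by
    conv_lhs => rw [matrix_eq_sum_single W]
    simp
  rw [pairing_eq_sum_single]
  refine Finset.sum_congr rfl fun a _ => Finset.sum_congr rfl fun a' _ => ?_
  conv_lhs => rw [hW]
  simp only [MultilinearMap.map_update_sum, MultilinearMap.map_update_smul, Finset.mul_sum,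
    smul_eq_mul, mul_assoc]

lemma expectedRisk_eq_of_nonSignalling [Nonempty A] [Nonempty X]
    {Q : SuperOp (A × (Fin n → X)) (Fin n → Y)} (hQ : NonSignalling Q) (S : Op (Y × Z))
    (ρA : Op A) {ρ : Op (X × Z)} (hρ : IsState ρ) :
    expectedRisk Q S ρA ρ = ∑ a, ∑ a', ∑ b, ∑ b', ρA a a' * riskWeight ρ S b b' *
      ((n : ℂ)⁻¹ * ∑ i, pairing (kernel Q) (single a a' 1)
        (Function.update (fun _ => maxMixed X ⊗ₖ (1 : Op Y)) i (single b b' 1))) := by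
  have hτ : (traceRight ρ).trace = 1 := by rw [trace_traceRight, hρ.2]
  rw [expectedRisk_eq]
  rw [Finset.sum_congr rfl fun i _ => pairing_update_eq_sum (kernel Q) ρA _ i _]
  simp_rw [hQ.pairing_eq _ _ _ _ hτ trace_maxMixed]
  rw [Finset.mul_sum]
  simp_rw [Finset.mul_sum]
  rw [Finset.sum_comm]
  refine Finset.sum_congr rfl fun a _ => ?_
  rw [Finset.sum_comm]
  refine Finset.sum_congr rfl fun a' _ => ?_
  rw [Finset.sum_comm]
  refine Finset.sum_congr rfl fun b _ => ?_
  rw [Finset.sum_comm]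
  refine Finset.sum_congr rfl fun b' _ => Finset.sum_congr rfl fun i _ => ?_
  ring

variable [Fintype G] [MeasurableSpace G] [MeasurableSingletonClass G]

lemma pairing_kernel_measurePrepare (E : G → Op A) (hE : ∀ g, (E g).PosSemidef)
    (hsum : ∑ g, E g = 1) (C : G → Op (X × Y)) (R : Op A) (N : Fin n → Op (X × Y)) :
    pairing (kernel (measurePrepare (finitePOVM E hE hsum) (fun g => ofChoi (C g)) n)) R N
      = ∑ g, (∑ a, ∑ a', R a a' * E g a' a) * ∏ i, ∑ b, ∑ b', N i b b' * C g b b' := by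
  have hk : ∀ (a a' : A) (β β' : Fin n → X × Y),
      kernel (measurePrepare (finitePOVM E hE hsum) (fun g => ofChoi (C g)) n) (a, β) (a', β')
        = ∑ g, E g a' a * ∏ i, C g (β i) (β' i) := fun a a' β β' =>
    choi_measurePrepare E hE hsum C a a' _ _ _ _
  have hprod : ∀ g, ∏ i, ∑ b, ∑ b', N i b b' * C g b b'
      = ∑ β : Fin n → X × Y, ∑ β' : Fin n → X × Y, ∏ i, N i (β i) (β' i) * C g (β i) (β' i) := by
    intro g
    rw [Fintype.prod_sum]
    refine Finset.sum_congr rfl fun β _ => ?_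
    rw [Fintype.prod_sum]
  simp_rw [pairing_apply, hk, hprod, Finset.sum_mul, Finset.mul_sum, Finset.sum_mul]
  have hswap : ∀ F : A → A → (Fin n → X × Y) → (Fin n → X × Y) → G → ℂ,
      ∑ a, ∑ a', ∑ β, ∑ β', ∑ g, F a a' β β' g = ∑ g, ∑ a, ∑ a', ∑ β, ∑ β', F a a' β β' g := by
    intro F
    rw [Finset.sum_comm (s := (Finset.univ : Finset G))]
    refine Finset.sum_congr rfl fun a _ => ?_
    rw [Finset.sum_comm (s := (Finset.univ : Finset G))]
    refine Finset.sum_congr rfl fun a' _ => ?_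
    rw [Finset.sum_comm (s := (Finset.univ : Finset G))]
    refine Finset.sum_congr rfl fun β _ => ?_
    rw [Finset.sum_comm]
  rw [hswap]
  refine Finset.sum_congr rfl fun g _ => Finset.sum_congr rfl fun a _ =>
    Finset.sum_congr rfl fun a' _ => Finset.sum_congr rfl fun β _ =>
    Finset.sum_congr rfl fun β' _ => ?_
  rw [Finset.prod_mul_distrib]
  ring

/-- For fixed `g` the registers factorize, and every register other than `i` contributes the trace
of a prepared state, namely `1`. All `n` terms therefore coincide. -/
lemma expectedRisk_measurePrepare (hn : 1 ≤ n) (E : G → Op A) (hE : ∀ g, (E g).PosSemidef)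
    (hsum : ∑ g, E g = 1) (C : G → Op (X × Y)) (htr : ∀ g, traceRight (C g) = 1)
    (S : Op (Y × Z)) (ρA : Op A) {ρ : Op (X × Z)} (hρ : IsState ρ) :
    expectedRisk (measurePrepare (finitePOVM E hE hsum) (fun g => ofChoi (C g)) n) S ρA ρ
      = ∑ a, ∑ a', ∑ b, ∑ b', ρA a a' * riskWeight ρ S b b' * ∑ g, E g a' a * C g b b' := by
  have hτ : (traceRight ρ).trace = 1 := by rw [trace_traceRight, hρ.2]
  have hn0 : (n : ℂ) ≠ 0 := by exact_mod_cast (by omega : n ≠ 0)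
  have hone : ∀ g, ∑ b, ∑ b', (traceRight ρ ⊗ₖ (1 : Op Y)) b b' * C g b b' = 1 := by
    intro g
    have h1 : ∀ x x', ∑ y, C g (x, y) (x', y) = (1 : Op X) x x' := fun x x' => by
      rw [← htr g]; rfl
    simp only [Fintype.sum_prod_type, kroneckerMap_apply, one_apply, mul_ite, mul_one, mul_zero,
      ite_mul, zero_mul, Finset.sum_ite_eq, Finset.mem_univ, if_true]
    calc _ = ∑ x, ∑ x', traceRight ρ x x' * ∑ y, C g (x, y) (x', y) := by
          refine Finset.sum_congr rfl fun x _ => ?_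
          rw [Finset.sum_comm]
          simp_rw [Finset.mul_sum]
      _ = 1 := by
          simp_rw [h1, one_apply]
          simpa [Matrix.trace] using hτ
  rw [expectedRisk_eq]
  simp_rw [pairing_kernel_measurePrepare]
  have hprod : ∀ (g : G) (i : Fin n), ∏ j, ∑ b, ∑ b', (Function.update
      (fun _ => traceRight ρ ⊗ₖ (1 : Op Y)) i (riskWeight ρ S) : Fin n → Op (X × Y)) j b b' *
        C g b b' = ∑ b, ∑ b', riskWeight ρ S b b' * C g b b' := by
    intro g i
    rw [Finset.prod_eq_single i]
    · simp
    · intro j _ hj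
      rw [Function.update_of_ne hj, hone]
    · simp
  simp_rw [hprod]
  rw [Finset.sum_const, Finset.card_univ, Fintype.card_fin, nsmul_eq_mul, inv_mul_cancel_left₀ hn0]
  simp_rw [Finset.sum_mul, Finset.mul_sum]
  rw [Finset.sum_comm]
  refine Finset.sum_congr rfl fun a _ => ?_
  rw [Finset.sum_comm]
  refine Finset.sum_congr rfl fun a' _ => ?_
  rw [Finset.sum_comm]
  refine Finset.sum_congr rfl fun b _ => ?_
  rw [Finset.sum_comm]
  refine Finset.sum_congr rfl fun b' _ => Finset.sum_congr rfl fun g _ => ?_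
  ring

end Risk

/-! ### Assembling the approximation -/

section Main

open Matrix
open scoped Kronecker

variable {A X Y Z : Type} [Fintype A] [Fintype X] [Fintype Y] [DecidableEq A]
  [DecidableEq X] [DecidableEq Y] [Nonempty A] [Nonempty X] [Nonempty Y] {n : ℕ}

lemma approxConst_nonneg : 0 ≤ approxConst A X Y := by
  have := (frameConst_pos (X := X) (Y := Y)).le
  unfold approxConst
  positivity

lemma norm_sum_mul_sub_le [Fintype Z] [DecidableEq Z] {ρA : Op A} (hA : IsState ρA)
    {ρ : Op (X × Z)} (hρ : IsState ρ) (S : Op (Y × Z)) (F F' : A → A → X × Y → X × Y → ℂ)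
    {δ : ℝ} (hF : ∀ a a' b b', ‖F a a' b b' - F' a a' b b'‖ ≤ δ) :
    ‖∑ a, ∑ a', ∑ b, ∑ b', ρA a a' * riskWeight ρ S b b' * F a a' b b' -
      ∑ a, ∑ a', ∑ b, ∑ b', ρA a a' * riskWeight ρ S b b' * F' a a' b b'‖
      ≤ opNorm S * ((Fintype.card A ^ 2 * Fintype.card (X × Y) ^ 2) * δ) := by
  simp_rw [← Finset.sum_sub_distrib, ← mul_sub]
  have hS : 0 ≤ opNorm S := norm_nonneg _
  have hA1 : ∀ a a', ‖ρA a a'‖ ≤ 1 := fun a a' => by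
    simpa [hA.2] using norm_apply_le_trace hA.1 a a'
  have hterm : ∀ a a' b b', ‖ρA a a' * riskWeight ρ S b b' * (F a a' b b' - F' a a' b b')‖
      ≤ opNorm S * δ := by
    intro a a' b b'
    rw [norm_mul, norm_mul]
    calc _ ≤ 1 * opNorm S * δ := by
          gcongr
          · exact hA1 a a'
          · exact norm_riskWeight_le hρ S b b'
          · exact hF a a' b b'
      _ = _ := by ring
  calc _ ≤ ∑ _a : A, ∑ _a' : A, ∑ _b : X × Y, ∑ _b' : X × Y, opNorm S * δ :=
        (norm_sum_le _ _).trans <| Finset.sum_le_sum fun a _ =>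
        (norm_sum_le _ _).trans <| Finset.sum_le_sum fun a' _ =>
        (norm_sum_le _ _).trans <| Finset.sum_le_sum fun b _ =>
        (norm_sum_le _ _).trans <| Finset.sum_le_sum fun b' _ => hterm a a' b b'
    _ = _ := by
        simp only [Finset.sum_const, Finset.card_univ, nsmul_eq_mul]
        ring

lemma one_div_sqrt_le_rpow (hn : 1 ≤ n) : 1 / √(n : ℝ) ≤ (n : ℝ) ^ (-(1 / 6) : ℝ) := by
  have h1 : (1 : ℝ) ≤ n := by exact_mod_cast hn
  rw [Real.sqrt_eq_rpow, one_div, ← Real.rpow_neg (by positivity)]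
  exact Real.rpow_le_rpow_of_exponent_le h1 (by norm_num)

theorem exists_measurePrepare_approx (hn : 1 ≤ n)
    {Q : SuperOp (A × (Fin n → X)) (Fin n → Y)} (hQ : IsChannel Q) (hNS : NonSignalling Q) :
    ∃ (G : Type) (_ : MeasurableSpace G) (M : POVM G A) (Φ : G → SuperOp X Y),
      (∀ g, IsChannel (Φ g)) ∧ (∀ ρ y v, Measurable fun g => Φ g ρ y v) ∧
      IsChannel (measurePrepare M Φ n) ∧
      ∀ (dZ : ℕ) (S : Op (Y × Fin dZ)) (ρA : Op A) (ρ : Op (X × Fin dZ)),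
        IsState ρA → IsState ρ →
        ‖expectedRisk Q S ρA ρ - expectedRisk (measurePrepare M Φ n) S ρA ρ‖
          ≤ opNorm S * ((Fintype.card A ^ 2 * Fintype.card (X × Y) ^ 2) *
            (approxConst A X Y / √n)) := by
  have hK : (kernel Q).PosSemidef := hQ.choi_posSemidef.submatrix _
  have hTP := hQ.isTracePreservingKernel
  let G := (Fin n → Bool) × (Fin n → FrameIndex (X × Y))
  let mG : MeasurableSpace G := ⊤
  -- An outcome is a uniformly random split together with the frame outcomes; the factor is the
  -- probability of the split.
  let E : G → Op A := fun g => (2 ^ n : ℂ)⁻¹ • frameEffect (kernel Q) g.2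
  let C : G → Op (X × Y) := fun g => repair (condOp (kernel Q) g.1 g.2)
  have hE : ∀ g, (E g).PosSemidef := fun g =>
    (frameEffect_posSemidef hK g.2).smul (by
      have : (2 ^ n : ℂ)⁻¹ = (((2 ^ n : ℝ)⁻¹ : ℝ) : ℂ) := by push_cast; rfl
      rw [this, Complex.zero_le_real]
      positivity)
  have hsum : ∑ g, E g = 1 := by
    simp only [E, G, Fintype.sum_prod_type, ← Finset.smul_sum, sum_frameEffect hTP]
    rw [Finset.sum_const, Finset.card_univ, ← Nat.cast_smul_eq_nsmul ℂ, smul_smul]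
    simp
  have hC : ∀ g, (C g).PosSemidef := fun g => repair_posSemidef (condOp_posSemidef hK g.1 g.2)
  have htr : ∀ g, traceRight (C g) = 1 := fun g => traceRight_repair _
  refine ⟨G, mG, finitePOVM E hE hsum, fun g => ofChoi (C g), fun g => ?_,
    fun ρ y v => measurable_from_top, isChannel_measurePrepare E hE hsum C hC htr, ?_⟩
  · exact isChannel_of_choi (by rw [choi_ofChoi]; exact hC g) (by rw [choi_ofChoi]; exact htr g)
  · intro dZ S ρA ρ hA hρ
    rw [expectedRisk_eq_of_nonSignalling hNS S ρA hρ,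
      expectedRisk_measurePrepare hn E hE hsum C htr S ρA hρ]
    exact norm_sum_mul_sub_le hA hρ S _ _ fun a a' b b' =>
      norm_average_pairing_sub_le hn hK hTP a a' b b'

end Main

end QLearn

end

theorem theorem1 (dA dX dY : ℕ) (hA : 0 < dA) (hX : 0 < dX) (hY : 0 < dY) :
    ∃ κ C : ℝ, ∀ n : ℕ, 1 ≤ n →
      ∀ Q : QLearn.SuperOp (Fin dA × (Fin n → Fin dX)) (Fin n → Fin dY),
        QLearn.IsChannel Q → QLearn.NonSignalling Q →
        ∃ (G : Type) (_ : MeasurableSpace G) (M : QLearn.POVM G (Fin dA))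
          (Φ : G → QLearn.SuperOp (Fin dX) (Fin dY)),
          (∀ g, QLearn.IsChannel (Φ g)) ∧
          (∀ ρ y v, Measurable fun g => Φ g ρ y v) ∧
          QLearn.IsChannel (QLearn.measurePrepare M Φ n) ∧
          ∀ (dZ : ℕ) (S : QLearn.Op (Fin dY × Fin dZ))
            (ρA : QLearn.Op (Fin dA)) (ρXZ : QLearn.Op (Fin dX × Fin dZ)),
            QLearn.IsState ρA → QLearn.IsState ρXZ →
            ‖QLearn.expectedRisk Q S ρA ρXZ
                - QLearn.expectedRisk (QLearn.measurePrepare M Φ n) S ρA ρXZ‖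
              ≤ QLearn.opNorm S *
                (κ * (n : ℝ) ^ (-(1 / 6) : ℝ) + C * (n : ℝ) ^ (-(1 / 3) : ℝ)) := by
  have : Nonempty (Fin dA) := ⟨⟨0, hA⟩⟩
  have : Nonempty (Fin dX) := ⟨⟨0, hX⟩⟩
  have : Nonempty (Fin dY) := ⟨⟨0, hY⟩⟩
  -- The cardinalities count the entries summed in the risk. The second constant can be `0` because
  -- the error is already `O(n^{-1/2})`.
  refine ⟨(Fintype.card (Fin dA) ^ 2 * Fintype.card (Fin dX × Fin dY) ^ 2) *
    QLearn.approxConst (Fin dA) (Fin dX) (Fin dY), 0, fun n hn Q hQ hNS => ?_⟩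
  obtain ⟨G, mG, M, Φ, h1, h2, h3, h4⟩ := QLearn.exists_measurePrepare_approx hn hQ hNS
  refine ⟨G, mG, M, Φ, h1, h2, h3, fun dZ S ρA ρXZ hρA hρ => (h4 dZ S ρA ρXZ hρA hρ).trans ?_⟩
  refine mul_le_mul_of_nonneg_left ?_ (norm_nonneg _)
  have hc := QLearn.approxConst_nonneg (A := Fin dA) (X := Fin dX) (Y := Fin dY)
  rw [zero_mul, add_zero, div_eq_mul_one_div, ← mul_assoc]
  gcongr
  exact QLearn.one_div_sqrt_le_rpow hn
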